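/- Let $(X,d)$ be a non-empty compact metric space and let $c:X\times X\to\mathbb R$ be continuous. For a bounded function $f:X\to\mathbb R$ put $$T^-f(x)=\inf_{y\in X}\big(f(y)+c(y,x)\big),\qquad T^+f(x)=\sup_{y\in X}\big(f(y)-c(x,y)\big).$$ Let $c[0]$ be the critical value, i.e. the unique real constant for which the equation $u=T^-u+c[0]$ has a (bounded) solution $u:X\to\mathbb R$. A *negative* (resp. *positive*) *weak KAM solution* is a bounded function $u$ with $u=T^-u+c[0]$ (resp. $u=T^+u-c[0]$). A *critical subsolution* is a function $u:X\to\mathbb R$ with $u(y)-u(x)\le c(x,y)+c[0]$ for all $x,y\in X$. The *projected Aubry set* $\mathcal A\subset X$ is the image under the first projection of the set of all $(x,y)\in X\times X$ such that $u(y)-u(x)=c(x,y)+c[0]$ for every continuous critical subsolution $u$. A *Mather measure* is a Borel probability measure $\mu$ on $X\times X$ with equal marginals, $\pi_{1*}\mu=\pi_{2*}\mu$, and $\int c\,d\mu=-c[0]$. A pair $(f,g)$ of real functions on $X$ is a *conjugate pair* if there is a critical subsolution $u$ such that, as $n\to+\infty$, $(T^-)^n u+n\,c[0]\to f$ and $(T^+)^n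 u-n\,c[0]\to g$ pointwise. For $\lambda\in(0,1)$ let $u_\lambda$ and $v_\lambda$ be the unique bounded functions with $u_\lambda=T^-(\lambda u_\lambda)$ and $v_\lambda=T^+(\lambda v_\lambda)$. Then, as $\lambda\to1^-$, $u_\lambda+\frac{c[0]}{1-\lambda}$ and $v_\lambda-\frac{c[0]}{1-\lambda}$ converge uniformly on $X$, to a negative weak KAM solution $u_1$ and to a positive weak KAM solution $v_1$ respectively. One has $u_1(x)\le v_1(x)$ for all $x\in\mathcal A$, and the following assertions are equivalent: 1. $(u_1,v_1)$ is a conjugate pair; 2. $u_1=v_1$ on $\mathcal A$; 3. $u_1\ge v_1$ on $X$; 4. $\int_X u_1\,d\pi_{1*}\mu=0$ for every Mather measure $\mu$; 5. $\int_X v_1\,d\pi_{1*}\mu=0$ for every Mather measure $\mu$; 6. there is a critical subsolution $v$ (not assumed continuous) such that, for every Mather measure $\mu$, $v$ is $\pi_{1*}\mu$-integrable and $\int_X v\,d\pi_{1*}\mu=0$. -/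

import Mathlib

open Filter Topology MeasureTheory

namespace DiscreteWeakKAM

/-- A real function is bounded (an element of the space of bounded functions on `X`). -/
def IsBdd {X : Type*} (f : X → ℝ) : Prop := ∃ M : ℝ, ∀ x, |f x| ≤ M

/-- The negative Lax--Oleinik operator `T⁻ f (x) = inf_y (f y + c (y, x))`. -/
noncomputable def laxNeg {X : Type*} (c : X → X → ℝ) (f : X → ℝ) : X → ℝ :=
  fun x => ⨅ y, (f y + c y x)

/-- The positive Lax--Oleinik operator `T⁺ f (x) = sup_y (f y - c (x, y))`. -/
noncomputable def laxPos {X : Type*} (c : X → X → ℝ) (f : X → ℝ) : X → ℝ :=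
  fun x => ⨆ y, (f y - c x y)

/-- `u = T⁻ u + κ`. -/
def IsNegWeakKAM {X : Type*} (c : X → X → ℝ) (κ : ℝ) (u : X → ℝ) : Prop :=
  IsBdd u ∧ ∀ x, u x = laxNeg c u x + κ

/-- `u = T⁺ u - κ`. -/
def IsPosWeakKAM {X : Type*} (c : X → X → ℝ) (κ : ℝ) (u : X → ℝ) : Prop :=
  IsBdd u ∧ ∀ x, u x = laxPos c u x - κ

/-- The critical value `c[0]`: the constant `κ` for which `u = T⁻ u + κ` has a solution. -/
noncomputable def criticalValue {X : Type*} (c : X → X → ℝ) : ℝ :=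
  Classical.epsilon fun κ : ℝ => ∃ u : X → ℝ, IsNegWeakKAM c κ u

/-- Critical subsolutions (no continuity or measurability is required). -/
def IsSubsolution {X : Type*} (c : X → X → ℝ) (u : X → ℝ) : Prop :=
  ∀ x y, u y - u x ≤ c x y + criticalValue c

/-- The non-strict set of `u`: pairs at which the subsolution inequality is an equality. -/
def nonStrictSet {X : Type*} (c : X → X → ℝ) (u : X → ℝ) : Set (X × X) :=
  {p | u p.2 - u p.1 = c p.1 p.2 + criticalValue c}

/-- The 2-Aubry set: the intersection of the non-strict sets of all continuous critical
subsolutions, that is, the non-strict set of a strict continuous subsolution. -/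
def twoAubrySet {X : Type*} [TopologicalSpace X] (c : X → X → ℝ) : Set (X × X) :=
  {p | ∀ u : X → ℝ, Continuous u → IsSubsolution c u → p ∈ nonStrictSet c u}

/-- The projected Aubry set. -/
def aubrySet {X : Type*} [TopologicalSpace X] (c : X → X → ℝ) : Set X :=
  Prod.fst '' twoAubrySet c

/-- Mather measures: closed probability measures on `X × X` (equal marginals) with
`∫ c dμ = -c[0]`. -/
structure IsMatherMeasure {X : Type*} [MeasurableSpace X] (c : X → X → ℝ)
    (μ : Measure (X × X)) : Prop where
  prob : IsProbabilityMeasure μ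
  closed : μ.map Prod.fst = μ.map Prod.snd
  minimizing : ∫ p, c p.1 p.2 ∂μ = -criticalValue c

/-- The first marginal of every Mather measure integrates `u` to zero. -/
def MatherIntegralZero {X : Type*} [MeasurableSpace X] (c : X → X → ℝ) (u : X → ℝ) : Prop :=
  ∀ μ : Measure (X × X), IsMatherMeasure c μ →
    Integrable u (μ.map Prod.fst) ∧ ∫ x, u x ∂(μ.map Prod.fst) = 0

/-- `(f, g)` is a conjugate pair: for some critical subsolution `u`, `f` and `g` are the limits
of `T⁻ⁿ u + n c[0]` and of `T⁺ⁿ u - n c[0]`. -/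
def IsConjugatePair {X : Type*} (c : X → X → ℝ) (f g : X → ℝ) : Prop :=
  ∃ u : X → ℝ, IsSubsolution c u ∧
    (∀ x, Tendsto (fun n : ℕ => (laxNeg c)^[n] u x + n * criticalValue c) atTop (𝓝 (f x))) ∧
    (∀ x, Tendsto (fun n : ℕ => (laxPos c)^[n] u x - n * criticalValue c) atTop (𝓝 (g x)))

/-- `u` is a bounded fixed point of `f ↦ T⁻ (lam f)`. -/
def IsDiscountedNeg {X : Type*} (c : X → X → ℝ) (lam : ℝ) (u : X → ℝ) : Prop :=
  IsBdd u ∧ ∀ x, u x = laxNeg c (fun y => lam * u y) x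

/-- `v` is a bounded fixed point of `f ↦ T⁺ (lam f)`. -/
def IsDiscountedPos {X : Type*} (c : X → X → ℝ) (lam : ℝ) (v : X → ℝ) : Prop :=
  IsBdd v ∧ ∀ x, v x = laxPos c (fun y => lam * v y) x

/-- `u_lam`, the bounded fixed point of `f ↦ T⁻ (lam f)`; see `existsUnique_discountedNeg`. -/
noncomputable def discountedNeg {X : Type*} (c : X → X → ℝ) (lam : ℝ) : X → ℝ :=
  Classical.epsilon (IsDiscountedNeg c lam)

/-- `v_lam`, the bounded fixed point of `f ↦ T⁺ (lam f)`; see `existsUnique_discountedPos`. -/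
noncomputable def discountedPos {X : Type*} (c : X → X → ℝ) (lam : ℝ) : X → ℝ :=
  Classical.epsilon (IsDiscountedPos c lam)

/-! There is at most one constant `κ` for which `u = T⁻ u + κ` has a solution. The discounted fixed points exist and are unique, so the choices above are meaningful. -/

theorem laxNeg_le_add {X : Type*} [Nonempty X] {c : X → X → ℝ} {f g : X → ℝ} {C K : ℝ}
    (hC : ∀ x y, |c x y| ≤ C) (hf : IsBdd f) (h : ∀ y, f y ≤ g y + K) (x : X) :
    laxNeg c f x ≤ laxNeg c g x + K := by
  obtain ⟨M, hM⟩ := hf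
  have hb : BddBelow (Set.range fun y => f y + c y x) := by
    refine ⟨-M - C, ?_⟩
    rintro _ ⟨y, rfl⟩
    have h1 := (abs_le.1 (hM y)).1
    have h2 := (abs_le.1 (hC y x)).1
    simp only
    linarith
  rw [← sub_le_iff_le_add]
  refine le_ciInf fun y => ?_
  have h1 : laxNeg c f x ≤ f y + c y x := ciInf_le hb y
  have h2 := h y
  linarith

theorem isNegWeakKAM_constant_unique {X : Type*} [Nonempty X] {c : X → X → ℝ} {C κ κ' : ℝ}
    {u v : X → ℝ} (hC : ∀ x y, |c x y| ≤ C) (hu : IsNegWeakKAM c κ u)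
    (hv : IsNegWeakKAM c κ' v) : κ = κ' := by
  have key : ∀ (a b : ℝ) (f g : X → ℝ), IsNegWeakKAM c a f → IsNegWeakKAM c b g → b ≤ a := by
    intro a b f g hf hg
    have hB : BddAbove (Set.range fun x => f x - g x) := by
      obtain ⟨M, hM⟩ := hf.1
      obtain ⟨N, hN⟩ := hg.1
      refine ⟨M + N, ?_⟩
      rintro _ ⟨x, rfl⟩
      have h1 := (abs_le.1 (hM x)).2
      have h2 := (abs_le.1 (hN x)).1
      simp only
      linarith
    set K := ⨆ x, (f x - g x)
    have hK : ∀ x, f x - g x ≤ K := fun x => le_ciSup hB x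
    have hle : K ≤ K + a - b := ciSup_le fun x => by
      have h1 := laxNeg_le_add (K := K) hC hf.1 (g := g) (fun y => by linarith [hK y]) x
      have h2 := hf.2 x
      have h3 := hg.2 x
      linarith
    linarith
  exact le_antisymm (key κ' κ v u hv hu) (key κ κ' u v hu hv)

theorem laxPos_eq_neg {X : Type*} (c : X → X → ℝ) (f : X → ℝ) (x : X) :
    laxPos c f x = -laxNeg (fun a b => c b a) (fun y => -f y) x := by
  unfold laxPos laxNeg
  rw [iInf, Real.sInf_def, neg_neg, iSup]
  congr 1
  ext t
  simp only [Set.mem_range, Set.mem_neg]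
  refine exists_congr fun y => ?_
  constructor <;> intro h <;> linarith

theorem existsUnique_discountedNeg {X : Type*} [TopologicalSpace X] [CompactSpace X] [Nonempty X]
    (c : X → X → ℝ) (hc : Continuous (Function.uncurry c)) (lam : ℝ) (h0 : 0 ≤ lam)
    (h1 : lam < 1) : ∃! u : X → ℝ, IsDiscountedNeg c lam u := by
  obtain ⟨C, hC⟩ : ∃ C : ℝ, ∀ x y, |c x y| ≤ C := by
    obtain ⟨C, hC⟩ := isCompact_univ.exists_bound_of_continuousOn hc.continuousOn
    exact ⟨C, fun x y => hC (x, y) trivial⟩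
  have hlip : ∀ f g : X → ℝ, IsBdd f → IsBdd g → ∀ K : ℝ, (∀ y, |f y - g y| ≤ K) → ∀ x,
      |laxNeg c (fun y => lam * f y) x - laxNeg c (fun y => lam * g y) x| ≤ lam * K := by
    have hs : ∀ f : X → ℝ, IsBdd f → IsBdd (fun y => lam * f y) := by
      rintro f ⟨M, hM⟩
      refine ⟨lam * M, fun x => ?_⟩
      rw [abs_mul, abs_of_nonneg h0]
      exact mul_le_mul_of_nonneg_left (hM x) h0
    intro f g hf hg K hK x
    rw [abs_le]
    have a := laxNeg_le_add (K := lam * K) hC (hs f hf) (g := fun y => lam * g y)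
      (fun y => by have := (abs_le.1 (hK y)).2; nlinarith) x
    have b := laxNeg_le_add (K := lam * K) hC (hs g hg) (g := fun y => lam * f y)
      (fun y => by have := (abs_le.1 (hK y)).1; nlinarith) x
    constructor <;> linarith
  have hbdd : ∀ f : C(X, ℝ), IsBdd f := fun f => ⟨‖f‖, fun x => f.norm_coe_le_norm x⟩
  have hcont : ∀ f : C(X, ℝ), Continuous (laxNeg c (fun y => lam * f y)) := by
    intro f
    have := isCompact_univ.continuous_sInf (K := (Set.univ : Set X))
      (f := fun (x y : X) => lam * f y + c y x)
      (by
        have : Continuous fun p : X × X => c p.2 p.1 := hc.comp continuous_swap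
        change Continuous fun p : X × X => lam * f p.2 + c p.2 p.1
        fun_prop)
    simp only [Set.image_univ] at this
    exact this
  let Φ : C(X, ℝ) → C(X, ℝ) := fun f => ⟨laxNeg c (fun y => lam * f y), hcont f⟩
  have hΦ : ContractingWith ⟨lam, h0⟩ Φ := by
    refine ⟨by exact_mod_cast h1, LipschitzWith.of_dist_le_mul fun f g => ?_⟩
    rw [ContinuousMap.dist_le (by positivity)]
    intro x
    exact hlip f g (hbdd f) (hbdd g) (dist f g) (fun y => by
      rw [← Real.dist_eq]; exact ContinuousMap.dist_apply_le_dist y) x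
  refine ⟨⇑(ContractingWith.fixedPoint Φ hΦ), ⟨hbdd _, fun x => ?_⟩, ?_⟩
  · exact (DFunLike.congr_fun hΦ.fixedPoint_isFixedPt x).symm
  · rintro v ⟨hv, hv'⟩
    set w : X → ℝ := ⇑(ContractingWith.fixedPoint Φ hΦ) with hw
    have hwf : ∀ x, w x = laxNeg c (fun y => lam * w y) x :=
      fun x => (DFunLike.congr_fun hΦ.fixedPoint_isFixedPt x).symm
    have hwb : IsBdd w := hbdd _
    have hB : BddAbove (Set.range fun x => |v x - w x|) := by
      obtain ⟨M, hM⟩ := hv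
      obtain ⟨N, hN⟩ := hwb
      refine ⟨M + N, ?_⟩
      rintro _ ⟨x, rfl⟩
      exact (abs_sub _ _).trans (add_le_add (hM x) (hN x))
    set K := ⨆ x, |v x - w x|
    have hK : ∀ x, |v x - w x| ≤ K := fun x => le_ciSup hB x
    have hKle : K ≤ lam * K := ciSup_le fun x => by
      have := hlip v w hv hwb K hK x
      rwa [← hv' x, ← hwf x] at this
    have hK0 : K ≤ 0 := by nlinarith
    funext x
    have := abs_nonpos_iff.1 ((hK x).trans hK0)
    linarith

theorem isDiscountedPos_iff {X : Type*} (c : X → X → ℝ) (lam : ℝ) (v : X → ℝ) :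
    IsDiscountedPos c lam v ↔ IsDiscountedNeg (fun a b => c b a) lam (fun y => -v y) := by
  simp only [IsDiscountedPos, IsDiscountedNeg, IsBdd, abs_neg, laxPos_eq_neg, mul_neg]
  refine and_congr_right fun _ => forall_congr' fun x => ?_
  constructor <;> intro h <;> linarith

theorem existsUnique_discountedPos {X : Type*} [TopologicalSpace X] [CompactSpace X] [Nonempty X]
    (c : X → X → ℝ) (hc : Continuous (Function.uncurry c)) (lam : ℝ) (h0 : 0 ≤ lam)
    (h1 : lam < 1) : ∃! v : X → ℝ, IsDiscountedPos c lam v := by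
  obtain ⟨u, hu, huniq⟩ := existsUnique_discountedNeg (fun a b => c b a)
    (hc.comp continuous_swap) lam h0 h1
  refine ⟨fun y => -u y, ?_, fun v hv => ?_⟩
  · refine (isDiscountedPos_iff c lam _).2 ?_
    simpa only [neg_neg] using hu
  · have := huniq _ ((isDiscountedPos_iff c lam v).1 hv)
    funext y
    rw [← this, neg_neg]

theorem discountedNeg_spec {X : Type*} [TopologicalSpace X] [CompactSpace X] [Nonempty X]
    (c : X → X → ℝ) (hc : Continuous (Function.uncurry c)) (lam : ℝ) (h0 : 0 ≤ lam)
    (h1 : lam < 1) : IsDiscountedNeg c lam (discountedNeg c lam) :=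
  Classical.epsilon_spec (existsUnique_discountedNeg c hc lam h0 h1).exists

theorem discountedPos_spec {X : Type*} [TopologicalSpace X] [CompactSpace X] [Nonempty X]
    (c : X → X → ℝ) (hc : Continuous (Function.uncurry c)) (lam : ℝ) (h0 : 0 ≤ lam)
    (h1 : lam < 1) : IsDiscountedPos c lam (discountedPos c lam) :=
  Classical.epsilon_spec (existsUnique_discountedPos c hc lam h0 h1).exists

end DiscreteWeakKAM

/-! The key is an extremal description of `u₁`: it is the largest continuous critical subsolution
whose integrals against first marginals of Mather measures are all nonpositive. Put `U =
normalizedNeg c lam`, so that `U = T⁻(lam U) + c[0]`. Integrating `U y ≤ lam U x + c x y + c[0]`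
against a Mather measure gives `(1 - lam) ∫ U ≤ 0`. Conversely, an optimal backward orbit from `x`,
weighted by `(1 - lam) lam ^ n`, yields measures whose limits are Mather measures, and telescoping a
subsolution `w` along it gives `w x - (mean of w) ≤ U x` (`le_of_tendsto_normalizedNeg`). All limit
points therefore dominate one another and coincide (`exists_tendstoUniformly_normalizedNeg`).

The positive case is the negative one for the swapped cost and opposite functions. The critical
value is unchanged, since `-c[0]` is the minimal cost of closed measures (`criticalValue_swap`). So
`v₁` is the smallest continuous subsolution with nonnegative Mather integrals.

The equivalences rest on the Aubry set: it carries the Mather measures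
(`IsMatherMeasure.ae_mem_twoAubrySet`), `T⁻ + c[0]` fixes every subsolution on it
(`IsSubsolution.laxNeg_eq_on_aubrySet`), and weak KAM solutions are determined by their values there
(`IsNegWeakKAM.eq_of_eq_on_aubrySet`). A possibly discontinuous `w` with zero integrals is thus
replaced by `T⁻ w + c[0]`, which the two extremal properties place between `v₁` and `u₁`. -/

namespace DiscreteWeakKAM

/-! ### The Lax–Oleinik operator and compactness -/

section LaxOleinik

variable {X : Type*}

theorem IsBdd.add_const {f : X → ℝ} (hf : IsBdd f) (a : ℝ) : IsBdd fun x => f x + a := by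
  obtain ⟨M, hM⟩ := hf
  exact ⟨M + |a|, fun x => (abs_add_le _ _).trans (by linarith [hM x])⟩

theorem IsBdd.const_mul {f : X → ℝ} (hf : IsBdd f) (a : ℝ) : IsBdd fun x => a * f x := by
  obtain ⟨M, hM⟩ := hf
  refine ⟨|a| * M, fun x => ?_⟩
  rw [abs_mul]
  exact mul_le_mul_of_nonneg_left (hM x) (abs_nonneg a)

theorem IsBdd.of_continuous [TopologicalSpace X] [CompactSpace X] {f : X → ℝ}
    (hf : Continuous f) : IsBdd f := by
  obtain ⟨C, hC⟩ := isCompact_univ.exists_bound_of_continuousOn hf.continuousOn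
  exact ⟨C, fun x => hC x trivial⟩

theorem exists_cost_bound [TopologicalSpace X] [CompactSpace X] {c : X → X → ℝ}
    (hc : Continuous (Function.uncurry c)) : ∃ C : ℝ, ∀ x y, |c x y| ≤ C := by
  obtain ⟨C, hC⟩ := IsBdd.of_continuous hc
  exact ⟨C, fun x y => hC (x, y)⟩

theorem laxNeg_le {c : X → X → ℝ} {C : ℝ} (hC : ∀ x y, |c x y| ≤ C) {f : X → ℝ}
    (hf : IsBdd f) (y x : X) : laxNeg c f x ≤ f y + c y x := by
  obtain ⟨M, hM⟩ := hf
  refine ciInf_le ⟨-M - C, ?_⟩ y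
  rintro _ ⟨z, rfl⟩
  have h1 := (abs_le.1 (hM z)).1
  have h2 := (abs_le.1 (hC z x)).1
  simp only
  linarith

theorem le_laxNeg [Nonempty X] {c : X → X → ℝ} {f : X → ℝ} {a : ℝ} {x : X}
    (h : ∀ y, a ≤ f y + c y x) : a ≤ laxNeg c f x :=
  le_ciInf h

theorem exists_laxNeg_eq [TopologicalSpace X] [CompactSpace X] [Nonempty X] {c : X → X → ℝ}
    (hc : Continuous (Function.uncurry c)) {f : X → ℝ} (hf : Continuous f) (x : X) :
    ∃ y, laxNeg c f x = f y + c y x := by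
  obtain ⟨C, hC⟩ := exists_cost_bound hc
  have hcont : Continuous fun y => f y + c y x :=
    hf.add (hc.comp (continuous_id.prodMk continuous_const))
  obtain ⟨y, -, hy⟩ := isCompact_univ.exists_isMinOn Set.univ_nonempty hcont.continuousOn
  refine ⟨y, le_antisymm (laxNeg_le hC (.of_continuous hf) y x) (le_laxNeg fun z => ?_)⟩
  exact hy (Set.mem_univ z)

theorem laxNeg_add_const [Nonempty X] {c : X → X → ℝ} {C : ℝ} (hC : ∀ x y, |c x y| ≤ C)
    {f : X → ℝ} (hf : IsBdd f) (a : ℝ) (x : X) :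
    laxNeg c (fun y => f y + a) x = laxNeg c f x + a := by
  refine le_antisymm (laxNeg_le_add hC (hf.add_const a) (fun y => le_rfl) x) ?_
  have := laxNeg_le_add (K := -a) hC hf (g := fun y => f y + a) (fun y => by linarith) x
  linarith

/-- The modulus of continuity comes from `c` alone, so it is uniform over all bounded `f`,
continuous or not. This supplies every equicontinuity used below. -/
theorem laxNeg_equicontinuous [PseudoMetricSpace X] [CompactSpace X] [Nonempty X]
    {c : X → X → ℝ} (hc : Continuous (Function.uncurry c)) {ε : ℝ} (hε : 0 < ε) :
    ∃ δ > 0, ∀ f : X → ℝ, IsBdd f → ∀ x y, dist x y < δ →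
      |laxNeg c f x - laxNeg c f y| ≤ ε := by
  obtain ⟨C, hC⟩ := exists_cost_bound hc
  obtain ⟨δ, hδ, h⟩ :=
    Metric.uniformContinuous_iff.1 (CompactSpace.uniformContinuous_of_continuous hc) ε hε
  have key : ∀ f : X → ℝ, IsBdd f → ∀ x y, dist x y < δ →
      laxNeg c f x ≤ laxNeg c f y + ε := by
    intro f hf x y hxy
    rw [← sub_le_iff_le_add]
    refine le_laxNeg fun z => ?_
    have h1 := laxNeg_le hC hf z x
    have h2 : dist (z, x) (z, y) < δ := by simpa [Prod.dist_eq, hδ] using hxy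
    have h3 := h h2
    rw [Real.dist_eq] at h3
    have h4 : c z x - c z y < ε := (abs_lt.1 h3).2
    linarith
  refine ⟨δ, hδ, fun f hf x y hxy => abs_le.2 ⟨?_, ?_⟩⟩
  · linarith [key f hf y x (by rwa [dist_comm])]
  · linarith [key f hf x y hxy]

theorem laxNeg_continuous [PseudoMetricSpace X] [CompactSpace X] [Nonempty X]
    {c : X → X → ℝ} (hc : Continuous (Function.uncurry c)) {f : X → ℝ} (hf : IsBdd f) :
    Continuous (laxNeg c f) := by
  refine Metric.continuous_iff.2 fun x ε hε => ?_
  obtain ⟨δ, hδ, h⟩ := laxNeg_equicontinuous hc (half_pos hε)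
  refine ⟨δ, hδ, fun y hy => ?_⟩
  rw [Real.dist_eq]
  linarith [h f hf y x hy]

theorem tendsto_laxNeg {ι : Type*} {L : Filter ι} [Nonempty X] {c : X → X → ℝ} {C : ℝ}
    (hC : ∀ x y, |c x y| ≤ C) {F : ι → X → ℝ} {f : X → ℝ} (hF : ∀ᶠ i in L, IsBdd (F i))
    (hf : IsBdd f) (h : TendstoUniformly F f L) (x : X) :
    Tendsto (fun i => laxNeg c (F i) x) L (𝓝 (laxNeg c f x)) := by
  refine Metric.tendsto_nhds.2 fun ε hε => ?_
  filter_upwards [hF, Metric.tendstoUniformly_iff.1 h (ε / 2) (half_pos hε)] with i hi hi'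
  have hd : ∀ y, |f y - F i y| < ε / 2 := fun y => by
    rw [← Real.dist_eq]
    exact hi' y
  have h1 := laxNeg_le_add (K := ε / 2) hC hf (g := F i)
    (fun y => by linarith [(abs_lt.1 (hd y)).2]) x
  have h2 := laxNeg_le_add (K := ε / 2) hC hi (g := f)
    (fun y => by linarith [(abs_lt.1 (hd y)).1]) x
  rw [Real.dist_eq, abs_lt]
  constructor <;> linarith

theorem tendstoUniformly_of_forall_tendsto [PseudoMetricSpace X] [CompactSpace X] {ι : Type*}
    {L : Filter ι} [L.NeBot] {F : ι → X → ℝ} {f : X → ℝ}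
    (heq : ∀ ε > 0, ∃ δ > 0, ∀ᶠ i in L, ∀ x y, dist x y < δ → |F i x - F i y| ≤ ε)
    (h : ∀ x, Tendsto (fun i => F i x) L (𝓝 (f x))) : TendstoUniformly F f L := by
  refine Metric.tendstoUniformly_iff.2 fun ε hε => ?_
  obtain ⟨δ, hδ, hF⟩ := heq (ε / 4) (by positivity)
  have hf : ∀ x y, dist x y < δ → |f x - f y| ≤ ε / 4 := fun x y hxy =>
    le_of_tendsto ((h x).sub (h y)).abs (hF.mono fun i hi => hi x y hxy)
  obtain ⟨t, -, htf, ht⟩ := Metric.finite_approx_of_totallyBounded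
    (isCompact_univ (X := X)).totallyBounded δ hδ
  have hev : ∀ᶠ i in L, ∀ z ∈ t, |F i z - f z| < ε / 4 := by
    refine (eventually_all_finite htf).2 fun z _ => ?_
    have := Metric.tendsto_nhds.1 (h z) (ε / 4) (by positivity)
    simpa only [Real.dist_eq] using this
  filter_upwards [hF, hev] with i hi hi' x
  obtain ⟨z, hz, hxz⟩ := Set.mem_iUnion₂.1 (ht (Set.mem_univ x))
  have h1 := abs_le.1 (hi x z hxz)
  have h2 := abs_le.1 (hf x z hxz)
  have h3 := abs_lt.1 (hi' z hz)
  rw [Real.dist_eq, abs_lt]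
  constructor <;> linarith

/-- Ascoli along an ultrafilter: bounded values converge automatically, and equicontinuity makes the
convergence uniform, with no extraction of subsequences. -/
theorem exists_tendstoUniformly [PseudoMetricSpace X] [CompactSpace X] {ι : Type*}
    {L : Ultrafilter ι} {F : ι → X → ℝ} {M : ℝ} (hM : ∀ᶠ i in L, ∀ x, |F i x| ≤ M)
    (heq : ∀ ε > 0, ∃ δ > 0, ∀ᶠ i in L, ∀ x y, dist x y < δ → |F i x - F i y| ≤ ε) :
    ∃ f : X → ℝ, (∀ x, |f x| ≤ M) ∧ TendstoUniformly F f L := by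
  have h : ∀ x, ∃ a, Tendsto (fun i => F i x) L (𝓝 a) := fun x => by
    have hx : Set.Icc (-M) M ∈ (L.map fun i => F i x : Filter ℝ) :=
      hM.mono fun i hi => abs_le.1 (hi x)
    obtain ⟨a, -, ha⟩ := isCompact_Icc.ultrafilter_le_nhds' (L.map fun i => F i x) hx
    exact ⟨a, ha⟩
  choose f hf using h
  exact ⟨f, fun x => le_of_tendsto (hf x).abs (hM.mono fun i hi => hi x),
    tendstoUniformly_of_forall_tendsto heq hf⟩

end LaxOleinik

/-! ### Discounted equations, existence of the critical value, uniform bounds -/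

section Discounted

variable {X : Type*}

theorem eventually_mem_Ioo_nhdsLT_one : ∀ᶠ lam : ℝ in 𝓝[<] (1 : ℝ), lam ∈ Set.Ioo (0 : ℝ) 1 :=
  Ioo_mem_nhdsLT zero_lt_one

/-- Comparison principle: `K = sup (f - g)` satisfies `K ≤ lam * K`, hence `K ≤ 0`. -/
theorem le_of_discounted_sub_super [Nonempty X] {c : X → X → ℝ} {C : ℝ}
    (hC : ∀ x y, |c x y| ≤ C) {lam κ : ℝ} (h0 : 0 ≤ lam) (h1 : lam < 1) {f g : X → ℝ}
    (hf : IsBdd f) (hg : IsBdd g) (hfs : ∀ x, f x ≤ laxNeg c (fun y => lam * f y) x + κ)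
    (hgs : ∀ x, laxNeg c (fun y => lam * g y) x + κ ≤ g x) (x : X) : f x ≤ g x := by
  have hB : BddAbove (Set.range fun x => f x - g x) := by
    obtain ⟨M, hM⟩ := hf
    obtain ⟨N, hN⟩ := hg
    refine ⟨M + N, ?_⟩
    rintro _ ⟨x, rfl⟩
    have h1 := (abs_le.1 (hM x)).2
    have h2 := (abs_le.1 (hN x)).1
    simp only
    linarith
  set K := ⨆ x, (f x - g x)
  have hK : ∀ x, f x - g x ≤ K := fun x => le_ciSup hB x
  have hle : K ≤ lam * K := ciSup_le fun x => by
    have := laxNeg_le_add (K := lam * K) hC (hf.const_mul lam) (g := fun y => lam * g y)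
      (fun y => by nlinarith [hK y]) x
    linarith [hfs x, hgs x]
  have hK0 : K ≤ 0 := by nlinarith
  linarith [hK x]

theorem isNegWeakKAM_of_tendstoUniformly [PseudoMetricSpace X] [CompactSpace X] [Nonempty X]
    {ι : Type*} {L : Filter ι} [L.NeBot] {c : X → X → ℝ} (hc : Continuous (Function.uncurry c))
    {F : ι → X → ℝ} {f : X → ℝ} {lam κ : ι → ℝ} {κ₁ M : ℝ} (hF : ∀ᶠ i in L, ∀ x, |F i x| ≤ M)
    (heq : ∀ᶠ i in L, ∀ x, F i x = laxNeg c (fun y => lam i * F i y) x + κ i)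
    (hlam : Tendsto lam L (𝓝 1)) (hκ : Tendsto κ L (𝓝 κ₁)) (h : TendstoUniformly F f L) :
    IsNegWeakKAM c κ₁ f := by
  obtain ⟨C, hC⟩ := exists_cost_bound hc
  have hfM : ∀ x, |f x| ≤ M := fun x =>
    le_of_tendsto (h.tendsto_at x).abs (hF.mono fun i hi => hi x)
  refine ⟨⟨M, hfM⟩, fun x => ?_⟩
  have hlamF : TendstoUniformly (fun i y => lam i * F i y) f L := by
    refine Metric.tendstoUniformly_iff.2 fun ε hε => ?_
    have hM : 0 ≤ M := (abs_nonneg _).trans (hfM x)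
    filter_upwards [hF, Metric.tendstoUniformly_iff.1 h (ε / 2) (half_pos hε),
      Metric.tendsto_nhds.1 hlam (ε / (2 * (M + 1))) (by positivity)] with i h1 h2 h3 y
    have h2 := h2 y
    rw [Real.dist_eq] at h2 h3 ⊢
    have h4 : |(1 - lam i) * F i y| ≤ ε / (2 * (M + 1)) * M := by
      rw [abs_mul, abs_sub_comm]
      exact mul_le_mul h3.le (h1 y) (abs_nonneg _) (by positivity)
    have h5 : ε / (2 * (M + 1)) * M ≤ ε / 2 := by
      rw [div_mul_eq_mul_div, div_le_div_iff₀ (by positivity) (by positivity)]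
      nlinarith
    calc |f y - lam i * F i y| = |(f y - F i y) + (1 - lam i) * F i y| := by ring_nf
      _ ≤ |f y - F i y| + |(1 - lam i) * F i y| := abs_add_le _ _
      _ < ε := by linarith
  have hb : ∀ᶠ i in L, IsBdd fun y => lam i * F i y :=
    hF.mono fun i hi => IsBdd.const_mul ⟨M, hi⟩ (lam i)
  have h1 := (tendsto_laxNeg hC hb ⟨M, hfM⟩ hlamF x).add hκ
  refine tendsto_nhds_unique (h.tendsto_at x) (h1.congr' ?_)
  filter_upwards [heq] with i hi
  exact (hi x).symm

/-- Vanishing discount: `u lam - u lam x₀` is bounded and equicontinuous, and the constants `-(1 -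
lam) * u lam x₀` are bounded, so both have limits along an ultrafilter; the second limit is the
constant sought. -/
theorem exists_isNegWeakKAM [PseudoMetricSpace X] [CompactSpace X] [Nonempty X]
    {c : X → X → ℝ} (hc : Continuous (Function.uncurry c)) :
    ∃ κ : ℝ, ∃ u : X → ℝ, IsNegWeakKAM c κ u := by
  obtain ⟨C, hC⟩ := exists_cost_bound hc
  obtain ⟨x₀⟩ := ‹Nonempty X›
  have : Nonempty X := ⟨x₀⟩
  let L : Ultrafilter ℝ := Ultrafilter.of (𝓝[<] (1 : ℝ))
  have hL : (L : Filter ℝ) ≤ 𝓝[<] (1 : ℝ) := Ultrafilter.of_le _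
  set u := discountedNeg c
  have hu : ∀ lam ∈ Set.Ioo (0 : ℝ) 1, IsDiscountedNeg c lam (u lam) := fun lam hlam =>
    discountedNeg_spec c hc lam hlam.1.le hlam.2
  have hosc : ∀ lam ∈ Set.Ioo (0 : ℝ) 1, ∀ x y, u lam x - u lam y ≤ 2 * C := by
    intro lam hlam x y
    have h := hu lam hlam
    rw [h.2 x, h.2 y, sub_le_comm]
    refine le_laxNeg fun z => ?_
    have h1 := laxNeg_le hC (h.1.const_mul lam) z x
    have h2 := abs_le.1 (hC z x)
    have h3 := abs_le.1 (hC z y)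
    linarith
  have hval : ∀ lam ∈ Set.Ioo (0 : ℝ) 1, |(1 - lam) * u lam x₀| ≤ 3 * C := by
    intro lam hlam
    have h := hu lam hlam
    have hC0 : 0 ≤ C := (abs_nonneg _).trans (hC x₀ x₀)
    have h1 := laxNeg_le hC (h.1.const_mul lam) x₀ x₀
    -- Of the `3 * C`, two come from the oscillation of `u lam` and one from the cost.
    have h2 : lam * u lam x₀ - 3 * C ≤ laxNeg c (fun y => lam * u lam y) x₀ := by
      refine le_laxNeg fun z => ?_
      have h3 := abs_le.1 (hC z x₀)
      have h4 := mul_le_mul_of_nonneg_left (hosc lam hlam x₀ z) hlam.1.le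
      have h5 : lam * (2 * C) ≤ 1 * (2 * C) :=
        mul_le_mul_of_nonneg_right hlam.2.le (by positivity)
      linarith
    rw [← h.2 x₀] at h1 h2
    have h3 := abs_le.1 (hC x₀ x₀)
    rw [abs_le]
    constructor <;> linarith
  set F : ℝ → X → ℝ := fun lam x => u lam x + -u lam x₀
  have hF : ∀ᶠ lam in (L : Filter ℝ), ∀ x, |F lam x| ≤ 2 * C := by
    filter_upwards [hL eventually_mem_Ioo_nhdsLT_one] with lam hlam x
    exact abs_le.2 ⟨by linarith [hosc lam hlam x₀ x], by linarith [hosc lam hlam x x₀]⟩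
  have hFeq : ∀ᶠ lam in (L : Filter ℝ), ∀ x,
      F lam x = laxNeg c (fun y => lam * F lam y) x + -((1 - lam) * u lam x₀) := by
    filter_upwards [hL eventually_mem_Ioo_nhdsLT_one] with lam hlam x
    have h1 : (fun y => lam * F lam y) = fun y => lam * u lam y + lam * -u lam x₀ := by
      funext y
      simp only [F]
      ring
    rw [h1, laxNeg_add_const hC ((hu lam hlam).1.const_mul lam), ← (hu lam hlam).2 x]
    simp only [F]
    ring
  have hequi : ∀ ε > 0, ∃ δ > 0, ∀ᶠ lam in (L : Filter ℝ), ∀ x y, dist x y < δ →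
      |F lam x - F lam y| ≤ ε := by
    intro ε hε
    obtain ⟨δ, hδ, h⟩ := laxNeg_equicontinuous hc hε
    refine ⟨δ, hδ, ?_⟩
    filter_upwards [hF, hFeq] with lam h1 h2 x y hxy
    rw [h2 x, h2 y, add_sub_add_right_eq_sub]
    exact h _ (IsBdd.const_mul ⟨_, h1⟩ lam) x y hxy
  obtain ⟨f, -, hf⟩ := exists_tendstoUniformly hF hequi
  obtain ⟨κ, -, hκ⟩ := (isCompact_Icc (a := -(3 * C)) (b := 3 * C)).ultrafilter_le_nhds'
    (L.map fun lam => -((1 - lam) * u lam x₀)) (by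
      change ∀ᶠ lam in (L : Filter ℝ), -((1 - lam) * u lam x₀) ∈ Set.Icc (-(3 * C)) (3 * C)
      filter_upwards [hL eventually_mem_Ioo_nhdsLT_one] with lam hlam
      rw [Set.mem_Icc, ← abs_le, abs_neg]
      exact hval lam hlam)
  have hlam : Tendsto (fun lam : ℝ => lam) (L : Filter ℝ) (𝓝 1) :=
    (tendsto_id'.2 (hL.trans nhdsWithin_le_nhds))
  exact ⟨κ, f, isNegWeakKAM_of_tendstoUniformly hc hF hFeq hlam hκ hf⟩

theorem exists_isNegWeakKAM_criticalValue [PseudoMetricSpace X] [CompactSpace X] [Nonempty X]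
    {c : X → X → ℝ} (hc : Continuous (Function.uncurry c)) :
    ∃ u : X → ℝ, IsNegWeakKAM c (criticalValue c) u :=
  Classical.epsilon_spec (exists_isNegWeakKAM hc)

theorem IsNegWeakKAM.continuous [PseudoMetricSpace X] [CompactSpace X] [Nonempty X]
    {c : X → X → ℝ} (hc : Continuous (Function.uncurry c)) {κ : ℝ} {u : X → ℝ}
    (hu : IsNegWeakKAM c κ u) : Continuous u := by
  have : u = fun x => laxNeg c u x + κ := funext hu.2
  rw [this]
  exact (laxNeg_continuous hc hu.1).add continuous_const

theorem IsNegWeakKAM.isSubsolution [TopologicalSpace X] [CompactSpace X]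
    {c : X → X → ℝ} (hc : Continuous (Function.uncurry c)) {u : X → ℝ}
    (hu : IsNegWeakKAM c (criticalValue c) u) : IsSubsolution c u := by
  obtain ⟨C, hC⟩ := exists_cost_bound hc
  intro x y
  linarith [hu.2 y, laxNeg_le hC hu.1 x y]

/-- The discounted solution normalized by the critical value. -/
noncomputable def normalizedNeg (c : X → X → ℝ) (lam : ℝ) (x : X) : ℝ :=
  discountedNeg c lam x + criticalValue c / (1 - lam)

theorem normalizedNeg_isBdd [TopologicalSpace X] [CompactSpace X] [Nonempty X]
    {c : X → X → ℝ} (hc : Continuous (Function.uncurry c)) {lam : ℝ}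
    (hlam : lam ∈ Set.Ioo (0 : ℝ) 1) : IsBdd (normalizedNeg c lam) :=
  (discountedNeg_spec c hc lam hlam.1.le hlam.2).1.add_const _

/-- With `κ` the critical value, the shift `κ / (1 - lam)` is the fixed point of `t ↦ lam * t + κ`.
-/
theorem normalizedNeg_eq [TopologicalSpace X] [CompactSpace X] [Nonempty X]
    {c : X → X → ℝ} (hc : Continuous (Function.uncurry c)) {lam : ℝ}
    (hlam : lam ∈ Set.Ioo (0 : ℝ) 1) (x : X) :
    normalizedNeg c lam x =
      laxNeg c (fun y => lam * normalizedNeg c lam y) x + criticalValue c := by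
  obtain ⟨C, hC⟩ := exists_cost_bound hc
  have hu := discountedNeg_spec c hc lam hlam.1.le hlam.2
  have h1 : (fun y => lam * normalizedNeg c lam y) =
      fun y => lam * discountedNeg c lam y + lam * (criticalValue c / (1 - lam)) := by
    funext y
    simp only [normalizedNeg]
    ring
  have h2 : (1 - lam) ≠ 0 := by linarith [hlam.2]
  rw [h1, laxNeg_add_const hC (hu.1.const_mul lam), ← hu.2 x, normalizedNeg]
  field_simp
  ring

/-- For a weak KAM solution `w` with `|w| ≤ B`, the signs of `w - B ≤ 0` and `w + B ≥ 0` make them a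
sub- and a supersolution of the discounted equation for every `lam`. -/
theorem exists_normalizedNeg_bound [PseudoMetricSpace X] [CompactSpace X] [Nonempty X]
    {c : X → X → ℝ} (hc : Continuous (Function.uncurry c)) :
    ∃ M : ℝ, ∀ lam ∈ Set.Ioo (0 : ℝ) 1, ∀ x, |normalizedNeg c lam x| ≤ M := by
  obtain ⟨C, hC⟩ := exists_cost_bound hc
  obtain ⟨w, hw⟩ := exists_isNegWeakKAM_criticalValue hc
  obtain ⟨B, hB⟩ := hw.1
  refine ⟨2 * B, fun lam hlam x => ?_⟩
  have hbd := normalizedNeg_isBdd hc hlam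
  have heq := normalizedNeg_eq hc hlam
  have hlow := le_of_discounted_sub_super hC hlam.1.le hlam.2 (hw.1.add_const (-B)) hbd
    (fun y => by
      have h1 := laxNeg_le_add (K := 0) hC (hw.1.add_const (-B))
        (g := fun y => lam * (w y + -B))
        (fun z => by nlinarith [(abs_le.1 (hB z)).2, hlam.2]) y
      rw [laxNeg_add_const hC hw.1] at h1
      linarith [hw.2 y]) (fun y => (heq y).ge) x
  have hup := le_of_discounted_sub_super hC hlam.1.le hlam.2 hbd (hw.1.add_const B)
    (fun y => (heq y).le) (fun y => by
      have h1 := laxNeg_le_add (K := 0) hC ((hw.1.add_const B).const_mul lam)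
        (g := fun y => w y + B)
        (fun z => by nlinarith [(abs_le.1 (hB z)).1, hlam.2]) y
      rw [laxNeg_add_const hC hw.1] at h1
      linarith [hw.2 y]) x
  have := abs_le.1 (hB x)
  exact abs_le.2 ⟨by linarith, by linarith⟩

theorem normalizedNeg_equicontinuous [PseudoMetricSpace X] [CompactSpace X] [Nonempty X]
    {c : X → X → ℝ} (hc : Continuous (Function.uncurry c)) {ε : ℝ} (hε : 0 < ε) :
    ∃ δ > 0, ∀ lam ∈ Set.Ioo (0 : ℝ) 1, ∀ x y, dist x y < δ →
      |normalizedNeg c lam x - normalizedNeg c lam y| ≤ ε := by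
  obtain ⟨δ, hδ, h⟩ := laxNeg_equicontinuous hc hε
  refine ⟨δ, hδ, fun lam hlam x y hxy => ?_⟩
  rw [normalizedNeg_eq hc hlam x, normalizedNeg_eq hc hlam y, add_sub_add_right_eq_sub]
  exact h _ ((normalizedNeg_isBdd hc hlam).const_mul lam) x y hxy

theorem normalizedNeg_continuous [PseudoMetricSpace X] [CompactSpace X] [Nonempty X]
    {c : X → X → ℝ} (hc : Continuous (Function.uncurry c)) {lam : ℝ}
    (hlam : lam ∈ Set.Ioo (0 : ℝ) 1) : Continuous (normalizedNeg c lam) := by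
  rw [funext (normalizedNeg_eq hc hlam)]
  exact (laxNeg_continuous hc ((normalizedNeg_isBdd hc hlam).const_mul lam)).add continuous_const

end Discounted

/-! ### Abel means and the measures they define on orbits -/

section AbelMean

/-- The Abel mean `(1 - lam) ∑ lam ^ n a n`. -/
noncomputable def abelMean (lam : ℝ) (a : ℕ → ℝ) : ℝ := (1 - lam) * ∑' n, lam ^ n * a n

variable {lam : ℝ}

theorem summable_pow_mul (h : lam ∈ Set.Ioo (0 : ℝ) 1) {a : ℕ → ℝ} (ha : IsBdd a) :
    Summable fun n => lam ^ n * a n := by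
  obtain ⟨M, hM⟩ := ha
  refine Summable.of_norm_bounded ((summable_geometric_of_lt_one h.1.le h.2).mul_right M)
    fun n => ?_
  rw [Real.norm_eq_abs, abs_mul, abs_of_pos (pow_pos h.1 n)]
  exact mul_le_mul_of_nonneg_left (hM n) (pow_pos h.1 n).le

theorem abelMean_const (h : lam ∈ Set.Ioo (0 : ℝ) 1) (K : ℝ) :
    abelMean lam (fun _ => K) = K := by
  have : (1 - lam) ≠ 0 := by linarith [h.2]
  rw [abelMean, tsum_mul_right, tsum_geometric_of_lt_one h.1.le h.2]
  field_simp

theorem abelMean_mono (h : lam ∈ Set.Ioo (0 : ℝ) 1) {a b : ℕ → ℝ} (ha : IsBdd a)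
    (hb : IsBdd b) (hab : ∀ n, a n ≤ b n) : abelMean lam a ≤ abelMean lam b :=
  mul_le_mul_of_nonneg_left ((summable_pow_mul h ha).tsum_le_tsum
    (fun n => mul_le_mul_of_nonneg_left (hab n) (pow_pos h.1 n).le) (summable_pow_mul h hb))
    (by linarith [h.2])

theorem abelMean_sub (h : lam ∈ Set.Ioo (0 : ℝ) 1) {a b : ℕ → ℝ} (ha : IsBdd a)
    (hb : IsBdd b) : abelMean lam (fun n => a n - b n) = abelMean lam a - abelMean lam b := by
  simp only [abelMean, mul_sub]
  rw [(summable_pow_mul h ha).tsum_sub (summable_pow_mul h hb), mul_sub]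

theorem abelMean_const_mul (K : ℝ) (a : ℕ → ℝ) :
    abelMean lam (fun n => K * a n) = K * abelMean lam a := by
  simp only [abelMean, mul_left_comm _ K]
  rw [tsum_mul_left, mul_left_comm]

/-- A shift of a bounded sequence moves its Abel mean by `O(1 - lam)`. This gives both the
closedness of limit measures and the telescoping along orbits. -/
theorem abelMean_eq_add_succ (h : lam ∈ Set.Ioo (0 : ℝ) 1) {a : ℕ → ℝ} (ha : IsBdd a) :
    abelMean lam a = (1 - lam) * a 0 + lam * abelMean lam (fun n => a (n + 1)) := by
  have h1 : (fun n => lam ^ (n + 1) * a (n + 1)) = fun n => lam * (lam ^ n * a (n + 1)) := by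
    funext n
    ring
  rw [abelMean, (summable_pow_mul h ha).tsum_eq_zero_add, h1, tsum_mul_left, abelMean]
  ring

theorem abs_abelMean_le (h : lam ∈ Set.Ioo (0 : ℝ) 1) {a : ℕ → ℝ} {M : ℝ}
    (ha : ∀ n, |a n| ≤ M) : |abelMean lam a| ≤ M := by
  have hc : ∀ K : ℝ, IsBdd fun _ : ℕ => K := fun K => ⟨|K|, fun _ => le_rfl⟩
  rw [abs_le]
  constructor
  · have := abelMean_mono h (hc (-M)) ⟨M, ha⟩ fun n => (abs_le.1 (ha n)).1
    rwa [abelMean_const h] at this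
  · have := abelMean_mono h ⟨M, ha⟩ (hc M) fun n => (abs_le.1 (ha n)).2
    rwa [abelMean_const h] at this

variable {Y : Type*} [MeasurableSpace Y]

/-- The probability measure on an orbit with Abel weights. -/
noncomputable def abelMeasure (lam : ℝ) (y : ℕ → Y) : Measure Y :=
  Measure.sum fun n => ENNReal.ofReal ((1 - lam) * lam ^ n) • Measure.dirac (y n)

theorem abelMeasure_isProbabilityMeasure (h : lam ∈ Set.Ioo (0 : ℝ) 1) (y : ℕ → Y) :
    IsProbabilityMeasure (abelMeasure lam y) := by
  have h1 : 0 < 1 - lam := by linarith [h.2]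
  refine ⟨?_⟩
  simp only [abelMeasure, Measure.sum_apply _ MeasurableSet.univ, Measure.smul_apply,
    measure_univ, smul_eq_mul, mul_one]
  rw [← ENNReal.ofReal_tsum_of_nonneg (fun n => mul_nonneg h1.le (pow_pos h.1 n).le)
    ((summable_geometric_of_lt_one h.1.le h.2).mul_left _), tsum_mul_left,
    tsum_geometric_of_lt_one h.1.le h.2, mul_inv_cancel₀ h1.ne', ENNReal.ofReal_one]

theorem integral_abelMeasure (h : lam ∈ Set.Ioo (0 : ℝ) 1) (y : ℕ → Y) {f : Y → ℝ}
    (hf : Measurable f) (hb : IsBdd f) :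
    ∫ p, f p ∂(abelMeasure lam y) = abelMean lam fun n => f (y n) := by
  have h1 : 0 < 1 - lam := by linarith [h.2]
  have := abelMeasure_isProbabilityMeasure h y
  obtain ⟨M, hM⟩ := hb
  have hint : Integrable f (abelMeasure lam y) :=
    Integrable.of_bound hf.aestronglyMeasurable M (Eventually.of_forall hM)
  rw [abelMeasure] at hint ⊢
  rw [integral_sum_measure hint, abelMean, ← tsum_mul_left]
  refine tsum_congr fun n => ?_
  rw [integral_smul_measure, integral_dirac' _ _ hf.stronglyMeasurable,
    ENNReal.toReal_ofReal (mul_nonneg h1.le (pow_pos h.1 n).le), smul_eq_mul, mul_assoc]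

end AbelMean

/-! ### Closed measures, minimality of `-c[0]`, and swapping the cost -/

section Measures

variable {X : Type*} [MetricSpace X] [CompactSpace X] [MeasurableSpace X] [BorelSpace X]

theorem integrable_of_continuous {Y : Type*} [TopologicalSpace Y] [CompactSpace Y]
    [MeasurableSpace Y] [OpensMeasurableSpace Y] {μ : Measure Y} [IsFiniteMeasure μ]
    {f : Y → ℝ} (hf : Continuous f) : Integrable f μ := by
  obtain ⟨M, hM⟩ := IsBdd.of_continuous hf
  exact Integrable.of_bound hf.measurable.aestronglyMeasurable M (Eventually.of_forall hM)

theorem integral_map_fst_of_continuous {μ : Measure (X × X)} {f : X → ℝ} (hf : Continuous f) :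
    ∫ x, f x ∂(μ.map Prod.fst) = ∫ p, f p.1 ∂μ :=
  integral_map measurable_fst.aemeasurable hf.measurable.aestronglyMeasurable

theorem integral_fst_eq_snd {μ : Measure (X × X)} (h : μ.map Prod.fst = μ.map Prod.snd)
    {f : X → ℝ} (hf : Continuous f) : ∫ p, f p.1 ∂μ = ∫ p, f p.2 ∂μ := by
  rw [← integral_map_fst_of_continuous hf, h]
  exact integral_map measurable_snd.aemeasurable hf.measurable.aestronglyMeasurable

theorem tendsto_one_sub_of_le_nhdsLT {L : Filter ℝ} (hL : L ≤ 𝓝[<] (1 : ℝ)) :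
    Tendsto (fun lam : ℝ => 1 - lam) L (𝓝 0) := by
  have h : Tendsto (fun lam : ℝ => 1 - lam) (𝓝 1) (𝓝 (1 - 1)) :=
    tendsto_const_nhds.sub tendsto_id
  rw [sub_self] at h
  exact h.mono_left (hL.trans nhdsWithin_le_nhds)

/-- Probability measures on the compact space `X × X` are weakly compact, and the two marginals
differ by a shift, negligible as `lam → 1`. Orbits run backward, hence the pairs `(s (n + 1), s n)`.
The orbit may depend on `lam`. -/
theorem exists_closed_limit_measure {L : Ultrafilter ℝ} (hL : (L : Filter ℝ) ≤ 𝓝[<] (1 : ℝ))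
    (s : ℝ → ℕ → X) : ∃ μ : Measure (X × X), IsProbabilityMeasure μ ∧
      μ.map Prod.fst = μ.map Prod.snd ∧ ∀ f : X × X → ℝ, Continuous f →
        Tendsto (fun lam => abelMean lam fun n => f (s lam (n + 1), s lam n)) L
          (𝓝 (∫ p, f p ∂μ)) := by
  have hev := hL eventually_mem_Ioo_nhdsLT_one
  have hP : ∀ lam, ∃ P : ProbabilityMeasure (X × X), lam ∈ Set.Ioo (0 : ℝ) 1 →
      (P : Measure (X × X)) = abelMeasure lam fun n => (s lam (n + 1), s lam n) := by
    intro lam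
    by_cases h : lam ∈ Set.Ioo (0 : ℝ) 1
    · exact ⟨⟨_, abelMeasure_isProbabilityMeasure h _⟩, fun _ => rfl⟩
    -- An arbitrary value: the limit only sees `lam` in `(0, 1)`.
    · exact ⟨⟨Measure.dirac (s 0 0, s 0 0), inferInstance⟩, fun h' => absurd h' h⟩
  choose P hP using hP
  obtain ⟨μ, -, hμ⟩ := isCompact_univ.ultrafilter_le_nhds' (L.map P) univ_mem
  have hlim : ∀ f : X × X → ℝ, Continuous f →
      Tendsto (fun lam => abelMean lam fun n => f (s lam (n + 1), s lam n)) L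
        (𝓝 (∫ p, f p ∂(μ : Measure (X × X)))) := by
    intro f hf
    have h1 := (ProbabilityMeasure.tendsto_iff_forall_integral_tendsto.1
      (show Tendsto P L (𝓝 μ) from hμ)) (BoundedContinuousFunction.mkOfCompact ⟨f, hf⟩)
    refine h1.congr' ?_
    filter_upwards [hev] with lam hlam
    rw [hP lam hlam]
    exact integral_abelMeasure hlam _ hf.measurable (.of_continuous hf)
  refine ⟨μ, inferInstance, ?_, hlim⟩
  have : IsFiniteMeasure ((μ : Measure (X × X)).map Prod.fst) := inferInstance
  have : IsFiniteMeasure ((μ : Measure (X × X)).map Prod.snd) := inferInstance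
  refine ext_of_forall_integral_eq_of_IsFiniteMeasure fun g => ?_
  rw [integral_map measurable_fst.aemeasurable g.continuous.measurable.aestronglyMeasurable,
    integral_map measurable_snd.aemeasurable g.continuous.measurable.aestronglyMeasurable]
  have h1 := hlim _ (g.continuous.comp continuous_fst)
  have h2 := hlim _ (g.continuous.comp continuous_snd)
  obtain ⟨M, hM⟩ := IsBdd.of_continuous g.continuous
  refine (sub_eq_zero.1 (tendsto_nhds_unique (h2.sub h1) ?_)).symm
  have hz : Tendsto (fun lam : ℝ => (1 - lam) * (M + M)) L (𝓝 0) := by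
    simpa using (tendsto_one_sub_of_le_nhdsLT hL).mul_const (M + M)
  refine squeeze_zero_norm' ?_ hz
  filter_upwards [hev] with lam hlam
  have h3 := abelMean_eq_add_succ hlam (a := fun n => g (s lam n)) ⟨M, fun n => hM _⟩
  have h4 := abs_abelMean_le hlam (a := fun n => g (s lam (n + 1))) (M := M) fun n => hM _
  have h5 : 0 ≤ 1 - lam := by linarith [hlam.2]
  simp only [Function.comp_apply]
  rw [h3, Real.norm_eq_abs]
  calc _ = |(1 - lam) * (g (s lam 0) - abelMean lam fun n => g (s lam (n + 1)))| := by
        congr 1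
        ring
    _ = (1 - lam) * |g (s lam 0) - abelMean lam fun n => g (s lam (n + 1))| := by
        rw [abs_mul, abs_of_nonneg h5]
    _ ≤ _ := mul_le_mul_of_nonneg_left ((abs_sub _ _).trans (add_le_add (hM _) h4)) h5

variable {c : X → X → ℝ}

theorem continuous_cost (hc : Continuous (Function.uncurry c)) :
    Continuous fun p : X × X => c p.1 p.2 := hc

/-- Integrate `u y - u x ≤ c x y + κ`; equal marginals kill the left side. -/
theorem neg_le_integral_of_isNegWeakKAM [Nonempty X] (hc : Continuous (Function.uncurry c))
    {κ : ℝ} {u : X → ℝ} (hu : IsNegWeakKAM c κ u) {μ : Measure (X × X)} [IsProbabilityMeasure μ]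
    (hμ : μ.map Prod.fst = μ.map Prod.snd) : -κ ≤ ∫ p, c p.1 p.2 ∂μ := by
  obtain ⟨C, hC⟩ := exists_cost_bound hc
  have hcont := hu.continuous hc
  have h1 : Integrable (fun p : X × X => u p.1) μ :=
    integrable_of_continuous (hcont.comp continuous_fst)
  have h2 : Integrable (fun p : X × X => u p.2) μ :=
    integrable_of_continuous (hcont.comp continuous_snd)
  have h3 : Integrable (fun p : X × X => c p.1 p.2) μ :=
    integrable_of_continuous (continuous_cost hc)
  have h4 : ∫ p, (u p.2 - u p.1 - κ) ∂μ ≤ ∫ p, c p.1 p.2 ∂μ :=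
    integral_mono ((h2.sub h1).sub (integrable_const _)) h3 fun p => by
      have := laxNeg_le hC hu.1 p.1 p.2
      simp only
      linarith [hu.2 p.2]
  have h5 : Integrable (fun p : X × X => u p.2 - u p.1) μ := h2.sub h1
  rw [integral_sub h5 (integrable_const _), integral_sub h2 h1,
    integral_fst_eq_snd hμ hcont] at h4
  simpa using h4

theorem IsNegWeakKAM.exists_calibrated [Nonempty X] (hc : Continuous (Function.uncurry c))
    {κ : ℝ} {u : X → ℝ} (hu : IsNegWeakKAM c κ u) (x : X) :
    ∃ s : ℕ → X, s 0 = x ∧ ∀ n, u (s n) - u (s (n + 1)) = c (s (n + 1)) (s n) + κ := by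
  have h : ∀ x, ∃ y, u x - u y = c y x + κ := fun x => by
    obtain ⟨y, hy⟩ := exists_laxNeg_eq hc (hu.continuous hc) x
    exact ⟨y, by linarith [hu.2 x]⟩
  choose b hb using h
  refine ⟨fun n => b^[n] x, rfl, fun n => ?_⟩
  simp only [Function.iterate_succ_apply']
  exact hb _

/-- Averaging along a calibrated backward orbit produces a minimizing closed measure. -/
theorem exists_minimizing_of_calibrated (hc : Continuous (Function.uncurry c)) {κ : ℝ}
    {u : X → ℝ} (hu : Continuous u) {s : ℕ → X}
    (hs : ∀ n, u (s n) - u (s (n + 1)) = c (s (n + 1)) (s n) + κ) :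
    ∃ μ : Measure (X × X), IsProbabilityMeasure μ ∧ μ.map Prod.fst = μ.map Prod.snd ∧
      ∫ p, c p.1 p.2 ∂μ = -κ ∧ ∀ f : X → ℝ, Continuous f → ∀ a, (∀ n, a ≤ f (s n)) →
        a ≤ ∫ x, f x ∂(μ.map Prod.fst) := by
  let L : Ultrafilter ℝ := Ultrafilter.of (𝓝[<] (1 : ℝ))
  have hL : (L : Filter ℝ) ≤ 𝓝[<] (1 : ℝ) := Ultrafilter.of_le _
  have hev := hL eventually_mem_Ioo_nhdsLT_one
  obtain ⟨μ, hprob, hclosed, hμ⟩ := exists_closed_limit_measure hL fun _ => s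
  have hconst : ∀ K : ℝ, IsBdd fun _ : ℕ => K := fun K => ⟨|K|, fun _ => le_rfl⟩
  refine ⟨μ, hprob, hclosed, ?_, fun f hf a ha => ?_⟩
  · obtain ⟨M, hM⟩ := IsBdd.of_continuous hu
    have h1 := hμ _ (continuous_cost hc)
    -- Along the orbit the cost is a coboundary of `u` minus `κ`, and the coboundary averages to
    -- zero because the limit is closed.
    have h2 := (hμ _ (hu.comp continuous_snd)).sub (hμ _ (hu.comp continuous_fst))
    simp only [Function.comp_apply] at h2
    rw [integral_fst_eq_snd hclosed hu, sub_self] at h2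
    have h3 := h2.sub_const κ
    rw [zero_sub] at h3
    refine tendsto_nhds_unique h1 (h3.congr' ?_)
    filter_upwards [hev] with lam hlam
    have hb1 : IsBdd fun n => u (s n) := ⟨M, fun n => hM _⟩
    have hb2 : IsBdd fun n => u (s (n + 1)) := ⟨M, fun n => hM _⟩
    have hb3 : IsBdd fun n => u (s n) - u (s (n + 1)) :=
      ⟨M + M, fun n => (abs_sub _ _).trans (add_le_add (hM _) (hM _))⟩
    rw [← abelMean_sub hlam hb1 hb2]
    conv_lhs => rw [← abelMean_const hlam κ]
    rw [← abelMean_sub hlam hb3 (hconst κ)]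
    congr 1
    funext n
    linarith [hs n]
  · rw [integral_map_fst_of_continuous hf]
    refine ge_of_tendsto (hμ _ (hf.comp continuous_fst)) ?_
    filter_upwards [hev] with lam hlam
    obtain ⟨M, hM⟩ := IsBdd.of_continuous hf
    have h1 := abelMean_mono hlam (hconst a) (b := fun n => f (s (n + 1))) ⟨M, fun n => hM _⟩
      fun n => ha _
    rwa [abelMean_const hlam] at h1

/-- A minimizing closed measure for `c`, once swapped, is a competitor of the same cost for the
swapped problem. -/
theorem criticalValue_swap_le [Nonempty X] (hc : Continuous (Function.uncurry c)) :
    criticalValue c ≤ criticalValue fun a b => c b a := by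
  have hc' : Continuous (Function.uncurry fun a b => c b a) := hc.comp continuous_swap
  obtain ⟨w, hw⟩ := exists_isNegWeakKAM_criticalValue hc
  obtain ⟨w', hw'⟩ := exists_isNegWeakKAM_criticalValue hc'
  obtain ⟨x⟩ := ‹Nonempty X›
  have : Nonempty X := ⟨x⟩
  obtain ⟨s, -, hs⟩ := hw.exists_calibrated hc x
  obtain ⟨μ, hprob, hclosed, hmin, -⟩ :=
    exists_minimizing_of_calibrated hc (hw.continuous hc) hs
  have hpr : IsProbabilityMeasure (μ.map Prod.swap) :=
    Measure.isProbabilityMeasure_map measurable_swap.aemeasurable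
  have h := neg_le_integral_of_isNegWeakKAM hc' hw' (μ := μ.map Prod.swap) (by
    rw [Measure.map_map measurable_fst measurable_swap,
      Measure.map_map measurable_snd measurable_swap]
    exact hclosed.symm)
  rw [integral_map measurable_swap.aemeasurable
    (continuous_cost hc').measurable.aestronglyMeasurable] at h
  simp only [Prod.fst_swap, Prod.snd_swap] at h
  linarith

theorem criticalValue_swap [Nonempty X] (hc : Continuous (Function.uncurry c)) :
    criticalValue (fun a b => c b a) = criticalValue c :=
  le_antisymm (criticalValue_swap_le (c := fun a b => c b a) (hc.comp continuous_swap))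
    (criticalValue_swap_le hc)

theorem IsMatherMeasure.swap [Nonempty X] (hc : Continuous (Function.uncurry c))
    {μ : Measure (X × X)} (hμ : IsMatherMeasure c μ) :
    IsMatherMeasure (fun a b => c b a) (μ.map Prod.swap) := by
  have := hμ.prob
  have hc' : Continuous (Function.uncurry fun a b => c b a) := hc.comp continuous_swap
  refine ⟨Measure.isProbabilityMeasure_map measurable_swap.aemeasurable, ?_, ?_⟩
  · rw [Measure.map_map measurable_fst measurable_swap,
      Measure.map_map measurable_snd measurable_swap]
    exact hμ.closed.symm
  · rw [criticalValue_swap hc, ← hμ.minimizing, integral_map measurable_swap.aemeasurable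
      (continuous_cost hc').measurable.aestronglyMeasurable]
    rfl

theorem IsMatherMeasure.map_fst_swap {μ : Measure (X × X)} (hμ : IsMatherMeasure c μ) :
    (μ.map Prod.swap).map Prod.fst = μ.map Prod.fst := by
  rw [Measure.map_map measurable_fst measurable_swap]
  exact hμ.closed.symm

end Measures

/-! ### Convergence of the discounted solutions and the extremal property of the limit -/

section Convergence

variable {X : Type*} [MetricSpace X] [CompactSpace X] [Nonempty X] [MeasurableSpace X]
  [BorelSpace X] {c : X → X → ℝ}

theorem normalizedNeg_integral_nonpos (hc : Continuous (Function.uncurry c)) {lam : ℝ}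
    (hlam : lam ∈ Set.Ioo (0 : ℝ) 1) {μ : Measure (X × X)} (hμ : IsMatherMeasure c μ) :
    ∫ x, normalizedNeg c lam x ∂(μ.map Prod.fst) ≤ 0 := by
  obtain ⟨C, hC⟩ := exists_cost_bound hc
  have := hμ.prob
  have hcont := normalizedNeg_continuous hc hlam
  have h1 : Integrable (fun p : X × X => lam * normalizedNeg c lam p.1) μ :=
    integrable_of_continuous (continuous_const.mul (hcont.comp continuous_fst))
  have h2 : Integrable (fun p : X × X => normalizedNeg c lam p.2) μ :=
    integrable_of_continuous (hcont.comp continuous_snd)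
  have h3 : Integrable (fun p : X × X => c p.1 p.2) μ :=
    integrable_of_continuous (continuous_cost hc)
  have h4 : Integrable (fun p : X × X => lam * normalizedNeg c lam p.1 + c p.1 p.2) μ :=
    h1.add h3
  have h5 : ∫ p, normalizedNeg c lam p.2 ∂μ ≤
      ∫ p, (lam * normalizedNeg c lam p.1 + c p.1 p.2 + criticalValue c) ∂μ :=
    integral_mono h2 (h4.add (integrable_const _)) fun p => by
      have := laxNeg_le hC ((normalizedNeg_isBdd hc hlam).const_mul lam) p.1 p.2
      simp only
      linarith [normalizedNeg_eq hc hlam p.2]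
  rw [integral_add h4 (integrable_const _), integral_add h1 h3, integral_const_mul,
    ← integral_fst_eq_snd hμ.closed hcont, hμ.minimizing] at h5
  simp only [integral_const, probReal_univ, smul_eq_mul, one_mul] at h5
  rw [integral_map_fst_of_continuous hcont]
  nlinarith [hlam.2]

theorem exists_discounted_orbit (hc : Continuous (Function.uncurry c)) {lam : ℝ}
    (hlam : lam ∈ Set.Ioo (0 : ℝ) 1) (x : X) :
    ∃ s : ℕ → X, s 0 = x ∧ ∀ n, normalizedNeg c lam (s n) =
      lam * normalizedNeg c lam (s (n + 1)) + c (s (n + 1)) (s n) + criticalValue c := by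
  have h : ∀ x, ∃ y, normalizedNeg c lam x =
      lam * normalizedNeg c lam y + c y x + criticalValue c := fun x => by
    have hcont : Continuous fun y => lam * normalizedNeg c lam y :=
      continuous_const.mul (normalizedNeg_continuous hc hlam)
    obtain ⟨y, hy⟩ := exists_laxNeg_eq hc hcont x
    exact ⟨y, by rw [normalizedNeg_eq hc hlam x, hy]⟩
  choose b hb using h
  refine ⟨fun n => b^[n] x, rfl, fun n => ?_⟩
  simp only [Function.iterate_succ_apply']
  exact hb _

/-- Averaging the subsolution inequality along an optimal orbit and dividing by `1 - lam` bounds `w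
x` by the discounted value plus a mean of `w`. The limit measure is a Mather measure, so the limit
of these means is nonpositive. -/
theorem le_of_tendsto_normalizedNeg (hc : Continuous (Function.uncurry c)) {L : Ultrafilter ℝ}
    (hL : (L : Filter ℝ) ≤ 𝓝[<] (1 : ℝ)) {x : X} {a : ℝ}
    (ha : Tendsto (fun lam => normalizedNeg c lam x) L (𝓝 a)) {w : X → ℝ} (hw : Continuous w)
    (hsub : IsSubsolution c w)
    (hint : ∀ μ, IsMatherMeasure c μ → ∫ x, w x ∂(μ.map Prod.fst) ≤ 0) : w x ≤ a := by
  have hev := hL eventually_mem_Ioo_nhdsLT_one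
  have h : ∀ lam, ∃ s : ℕ → X, lam ∈ Set.Ioo (0 : ℝ) 1 → s 0 = x ∧ ∀ n,
      normalizedNeg c lam (s n) =
        lam * normalizedNeg c lam (s (n + 1)) + c (s (n + 1)) (s n) + criticalValue c := by
    intro lam
    by_cases hlam : lam ∈ Set.Ioo (0 : ℝ) 1
    · obtain ⟨s, hs⟩ := exists_discounted_orbit hc hlam x
      exact ⟨s, fun _ => hs⟩
    · exact ⟨fun _ => x, fun h => absurd h hlam⟩
  choose s hs using h
  have hconst : ∀ K : ℝ, IsBdd fun _ : ℕ => K := fun K => ⟨|K|, fun _ => le_rfl⟩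
  have habel : ∀ lam ∈ Set.Ioo (0 : ℝ) 1,
      abelMean lam (fun n => normalizedNeg c lam (s lam n)
        - lam * normalizedNeg c lam (s lam (n + 1))) = (1 - lam) * normalizedNeg c lam x := by
    intro lam hlam
    obtain ⟨M, hM⟩ := normalizedNeg_isBdd hc hlam
    have hb1 : IsBdd fun n => normalizedNeg c lam (s lam n) := ⟨M, fun n => hM _⟩
    have hb2 : IsBdd fun n => normalizedNeg c lam (s lam (n + 1)) := ⟨M, fun n => hM _⟩
    rw [abelMean_sub hlam hb1 (hb2.const_mul lam), abelMean_const_mul,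
      abelMean_eq_add_succ hlam hb1, (hs lam hlam).1]
    ring
  obtain ⟨μ, hprob, hclosed, hμ⟩ := exists_closed_limit_measure hL s
  obtain ⟨C, hC⟩ := exists_cost_bound hc
  -- The mean of `c + c[0]` equals `(1 - lam) * normalizedNeg c lam x`, which tends to zero.
  have hmather : IsMatherMeasure c μ := by
    refine ⟨hprob, hclosed, tendsto_nhds_unique (hμ _ (continuous_cost hc)) ?_⟩
    have h1 := ((tendsto_one_sub_of_le_nhdsLT hL).mul ha).sub_const (criticalValue c)
    rw [zero_mul, zero_sub] at h1
    refine h1.congr' ?_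
    filter_upwards [hev] with lam hlam
    have hb : IsBdd fun n => c (s lam (n + 1)) (s lam n) := ⟨C, fun n => hC _ _⟩
    rw [← habel lam hlam]
    conv_lhs => rw [← abelMean_const hlam (criticalValue c)]
    rw [← abelMean_sub hlam _ (hconst _)]
    · congr 1
      funext n
      linarith [(hs lam hlam).2 n]
    · have : (fun n => normalizedNeg c lam (s lam n)
          - lam * normalizedNeg c lam (s lam (n + 1))) =
          fun n => c (s lam (n + 1)) (s lam n) + criticalValue c := by
        funext n
        linarith [(hs lam hlam).2 n]
      rw [this]
      exact hb.add_const _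
  have hlim := hμ _ (hw.comp continuous_fst)
  have hle : ∀ᶠ lam in (L : Filter ℝ),
      w x - abelMean lam (fun n => w (s lam (n + 1))) ≤ normalizedNeg c lam x := by
    filter_upwards [hev] with lam hlam
    obtain ⟨M, hM⟩ := IsBdd.of_continuous hw
    obtain ⟨N, hN⟩ := normalizedNeg_isBdd hc hlam
    have hb1 : IsBdd fun n => w (s lam n) := ⟨M, fun n => hM _⟩
    have hb2 : IsBdd fun n => w (s lam (n + 1)) := ⟨M, fun n => hM _⟩
    have hb3 : IsBdd fun n => w (s lam n) - w (s lam (n + 1)) :=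
      ⟨M + M, fun n => (abs_sub _ _).trans (add_le_add (hM _) (hM _))⟩
    have hb4 : IsBdd fun n => normalizedNeg c lam (s lam n)
        - lam * normalizedNeg c lam (s lam (n + 1)) := by
      refine ⟨N + |lam| * N, fun n => (abs_sub _ _).trans (add_le_add (hN _) ?_)⟩
      rw [abs_mul]
      exact mul_le_mul_of_nonneg_left (hN _) (abs_nonneg _)
    have h1 := abelMean_mono hlam hb3 hb4 fun n => by
      linarith [hsub (s lam (n + 1)) (s lam n), (hs lam hlam).2 n]
    rw [habel lam hlam, abelMean_sub hlam hb1 hb2, abelMean_eq_add_succ hlam hb1,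
      (hs lam hlam).1] at h1
    nlinarith [hlam.2]
  have h1 := le_of_tendsto_of_tendsto (hlim.const_sub (w x)) ha hle
  have h2 := hint μ hmather
  rw [integral_map_fst_of_continuous hw] at h2
  simp only [Function.comp_apply] at h1
  linarith

/-- Convergence of the normalized discounted solutions, and a characterization of the limit as
the largest continuous subsolution with nonpositive integrals against Mather measures. -/
theorem exists_tendstoUniformly_normalizedNeg (hc : Continuous (Function.uncurry c)) :
    ∃ u : X → ℝ, TendstoUniformly (normalizedNeg c) u (𝓝[<] (1 : ℝ)) ∧
      IsNegWeakKAM c (criticalValue c) u ∧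
      (∀ μ, IsMatherMeasure c μ → ∫ x, u x ∂(μ.map Prod.fst) ≤ 0) ∧
      ∀ w : X → ℝ, Continuous w → IsSubsolution c w →
        (∀ μ, IsMatherMeasure c μ → ∫ x, w x ∂(μ.map Prod.fst) ≤ 0) → ∀ x, w x ≤ u x := by
  obtain ⟨M, hM⟩ := exists_normalizedNeg_bound hc
  have hequi : ∀ {L : Filter ℝ}, L ≤ 𝓝[<] (1 : ℝ) → ∀ ε > 0, ∃ δ > 0, ∀ᶠ lam in L,
      ∀ x y, dist x y < δ → |normalizedNeg c lam x - normalizedNeg c lam y| ≤ ε := by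
    intro L hL ε hε
    obtain ⟨δ, hδ, h⟩ := normalizedNeg_equicontinuous hc hε
    have hev : ∀ᶠ lam in L, lam ∈ Set.Ioo (0 : ℝ) 1 := hL eventually_mem_Ioo_nhdsLT_one
    exact ⟨δ, hδ, hev.mono h⟩
  have key : ∀ L : Ultrafilter ℝ, (L : Filter ℝ) ≤ 𝓝[<] (1 : ℝ) → ∃ u : X → ℝ,
      TendstoUniformly (normalizedNeg c) u L ∧ IsNegWeakKAM c (criticalValue c) u ∧
      ∀ μ, IsMatherMeasure c μ → ∫ x, u x ∂(μ.map Prod.fst) ≤ 0 := by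
    intro L hL
    have hev : ∀ᶠ lam in (L : Filter ℝ), lam ∈ Set.Ioo (0 : ℝ) 1 :=
      hL eventually_mem_Ioo_nhdsLT_one
    have hbd : ∀ᶠ lam in (L : Filter ℝ), ∀ x, |normalizedNeg c lam x| ≤ M := hev.mono hM
    obtain ⟨u, -, hu⟩ := exists_tendstoUniformly hbd (hequi hL)
    have hlam : Tendsto (fun lam : ℝ => lam) (L : Filter ℝ) (𝓝 1) :=
      tendsto_id'.2 (hL.trans nhdsWithin_le_nhds)
    have hweak := isNegWeakKAM_of_tendstoUniformly hc hbd
      (hev.mono fun lam h => normalizedNeg_eq hc h) hlam tendsto_const_nhds hu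
    refine ⟨u, hu, hweak, fun μ hμ => le_of_forall_pos_le_add fun ε hε => ?_⟩
    have := hμ.prob
    have : IsProbabilityMeasure (μ.map Prod.fst) :=
      Measure.isProbabilityMeasure_map measurable_fst.aemeasurable
    obtain ⟨lam, hlam, hd⟩ := (hev.and (Metric.tendstoUniformly_iff.1 hu ε hε)).exists
    have hi : Integrable (normalizedNeg c lam) (μ.map Prod.fst) :=
      integrable_of_continuous (normalizedNeg_continuous hc hlam)
    have h1 : ∫ x, u x ∂(μ.map Prod.fst) ≤ ∫ x, (normalizedNeg c lam x + ε) ∂(μ.map Prod.fst) :=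
      integral_mono (integrable_of_continuous (hweak.continuous hc))
        (hi.add (integrable_const ε)) fun x => by
          have := hd x
          rw [Real.dist_eq] at this
          simp only
          linarith [(abs_lt.1 this).2]
    rw [integral_add hi (integrable_const ε)] at h1
    simp only [integral_const, probReal_univ, smul_eq_mul, one_mul] at h1
    linarith [normalizedNeg_integral_nonpos hc hlam hμ]
  obtain ⟨u, hu, hweak, hint⟩ := key (Ultrafilter.of (𝓝[<] (1 : ℝ))) (Ultrafilter.of_le _)
  have hmax : ∀ w : X → ℝ, Continuous w → IsSubsolution c w →
      (∀ μ, IsMatherMeasure c μ → ∫ x, w x ∂(μ.map Prod.fst) ≤ 0) → ∀ x, w x ≤ u x :=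
    fun w hw hsub h x =>
      le_of_tendsto_normalizedNeg hc (Ultrafilter.of_le _) (hu.tendsto_at x) hw hsub h
  refine ⟨u, tendstoUniformly_of_forall_tendsto (hequi le_rfl) fun x => ?_, hweak, hint, hmax⟩
  -- The limit along any other ultrafilter satisfies the same constraints as `u`, so each of the two
  -- dominates the other.
  refine (tendsto_iff_ultrafilter _ _ _).2 fun L hL => ?_
  obtain ⟨f, hf, hf1, hf2⟩ := key L hL
  have : f x = u x := le_antisymm (hmax f (hf1.continuous hc) (hf1.isSubsolution hc) hf2 x)
    (le_of_tendsto_normalizedNeg hc hL (hf.tendsto_at x) (hweak.continuous hc)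
      (hweak.isSubsolution hc) hint)
  rw [← this]
  exact hf.tendsto_at x

/-- Comparison of a subsolution with a weak KAM solution through Mather measures. -/
theorem IsNegWeakKAM.le_of_integral_sub_nonpos (hc : Continuous (Function.uncurry c))
    {u w : X → ℝ} (hu : IsNegWeakKAM c (criticalValue c) u) (hw : Continuous w)
    (hsub : IsSubsolution c w)
    (h : ∀ μ, IsMatherMeasure c μ → ∫ x, (w x - u x) ∂(μ.map Prod.fst) ≤ 0) (x : X) :
    w x ≤ u x := by
  obtain ⟨s, hs0, hs⟩ := hu.exists_calibrated hc x
  have hcont := hu.continuous hc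
  obtain ⟨μ, h1, h2, h3, h4⟩ := exists_minimizing_of_calibrated hc hcont hs
  -- `w - u` cannot decrease going backward along an orbit calibrated by `u`, so its integral
  -- against the limit measure is at least its value at `x`.
  have hmono : ∀ n, w x - u x ≤ w (s n) - u (s n) := by
    intro n
    induction n with
    | zero => rw [hs0]
    | succ n ih => linarith [hsub (s (n + 1)) (s n), hs n]
  have hdiff : Continuous fun x => w x - u x := hw.sub hcont
  linarith [h4 _ hdiff _ hmono, h μ ⟨h1, h2, h3⟩]

end Convergence

/-! ### Iterating subsolutions, and their rigidity on the Aubry set -/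

section Subsolutions

variable {X : Type*} [MetricSpace X] [CompactSpace X] [Nonempty X] {c : X → X → ℝ}

theorem IsSubsolution.isBdd (hc : Continuous (Function.uncurry c)) {u : X → ℝ}
    (hu : IsSubsolution c u) : IsBdd u := by
  obtain ⟨C, hC⟩ := exists_cost_bound hc
  obtain ⟨x₀⟩ := ‹Nonempty X›
  refine ⟨|u x₀| + C + |criticalValue c|, fun x => abs_le.2 ?_⟩
  have h1 := hu x x₀
  have h2 := hu x₀ x
  have h3 := (abs_le.1 (hC x x₀)).2
  have h4 := (abs_le.1 (hC x₀ x)).2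
  have h5 := le_abs_self (criticalValue c)
  have h6 := abs_le.1 (le_refl |u x₀|)
  constructor <;> linarith

theorem IsSubsolution.le_laxNeg_add {u : X → ℝ} (hu : IsSubsolution c u) (x : X) :
    u x ≤ laxNeg c u x + criticalValue c := by
  rw [← sub_le_iff_le_add]
  exact le_laxNeg fun y => by linarith [hu y x]

/-- Follows from `u ≤ T⁻ u + c[0]`. This regularizes arbitrary subsolutions, since the image is
continuous. -/
theorem IsSubsolution.laxNeg_add (hc : Continuous (Function.uncurry c)) {u : X → ℝ}
    (hu : IsSubsolution c u) : IsSubsolution c fun x => laxNeg c u x + criticalValue c := by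
  obtain ⟨C, hC⟩ := exists_cost_bound hc
  intro x y
  have := laxNeg_le hC (hu.isBdd hc) x y
  simp only
  linarith [hu.le_laxNeg_add x]

theorem laxNeg_iterate_isBdd (hc : Continuous (Function.uncurry c)) {u : X → ℝ} (hu : IsBdd u)
    (n : ℕ) : IsBdd ((laxNeg c)^[n] u) := by
  induction n with
  | zero => exact hu
  | succ n ih =>
    rw [Function.iterate_succ_apply']
    exact .of_continuous (laxNeg_continuous hc ih)

theorem laxNeg_iterate_succ_add (hc : Continuous (Function.uncurry c)) {u : X → ℝ}
    (hu : IsBdd u) (κ : ℝ) (n : ℕ) (x : X) :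
    (laxNeg c)^[n + 1] u x + (n + 1 : ℕ) * κ =
      laxNeg c (fun y => (laxNeg c)^[n] u y + n * κ) x + κ := by
  obtain ⟨C, hC⟩ := exists_cost_bound hc
  rw [laxNeg_add_const hC (laxNeg_iterate_isBdd hc hu n), Function.iterate_succ_apply']
  push_cast
  ring

theorem IsSubsolution.iterate (hc : Continuous (Function.uncurry c)) {u : X → ℝ}
    (hu : IsSubsolution c u) (n : ℕ) :
    IsSubsolution c fun x => (laxNeg c)^[n] u x + n * criticalValue c := by
  induction n with
  | zero => simpa using hu
  | succ n ih =>
    rw [funext (laxNeg_iterate_succ_add hc (hu.isBdd hc) (criticalValue c) n)]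
    exact ih.laxNeg_add hc

/-- The normalized iterates increase and stay below a weak KAM solution shifted upward;
equicontinuity makes the limit uniform, so it is a fixed point. -/
theorem IsSubsolution.exists_tendsto_iterate (hc : Continuous (Function.uncurry c)) {u : X → ℝ}
    (hu : IsSubsolution c u) : ∃ f : X → ℝ, IsNegWeakKAM c (criticalValue c) f ∧
      (∀ x, Tendsto (fun n : ℕ => (laxNeg c)^[n] u x + n * criticalValue c) atTop (𝓝 (f x))) ∧
      ∀ x, u x ≤ f x := by
  obtain ⟨C, hC⟩ := exists_cost_bound hc
  obtain ⟨w, hw⟩ := exists_isNegWeakKAM_criticalValue hc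
  obtain ⟨A, hA⟩ := hw.1
  obtain ⟨B, hB⟩ := hu.isBdd hc
  set g : ℕ → X → ℝ := fun n x => (laxNeg c)^[n] u x + n * criticalValue c
  have hg0 : ∀ x, g 0 x = u x := fun x => by simp [g]
  have hgsub : ∀ n, IsSubsolution c (g n) := hu.iterate hc
  have hgbd : ∀ n, IsBdd (g n) := fun n => (hgsub n).isBdd hc
  have hsucc : ∀ n x, g (n + 1) x = laxNeg c (g n) x + criticalValue c := fun n x =>
    laxNeg_iterate_succ_add hc (hu.isBdd hc) (criticalValue c) n x
  have hmono : ∀ x, Monotone fun n => g n x := fun x => monotone_nat_of_le_succ fun n => by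
    rw [hsucc]
    exact (hgsub n).le_laxNeg_add x
  have hupper : ∀ n x, g n x ≤ w x + (A + B) := by
    intro n
    induction n with
    | zero =>
      intro x
      rw [hg0]
      linarith [(abs_le.1 (hA x)).1, (abs_le.1 (hB x)).2]
    | succ n ih =>
      intro x
      rw [hsucc, hw.2 x]
      linarith [laxNeg_le_add hC (hgbd n) ih x]
  have hbdd : ∀ x, BddAbove (Set.range fun n => g n x) := fun x => by
    refine ⟨w x + (A + B), ?_⟩
    rintro _ ⟨n, rfl⟩
    exact hupper n x
  set f : X → ℝ := fun x => ⨆ n, g n x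
  have hlim : ∀ x, Tendsto (fun n => g n x) atTop (𝓝 (f x)) := fun x =>
    tendsto_atTop_ciSup (hmono x) (hbdd x)
  have huf : ∀ x, u x ≤ f x := fun x => by
    rw [← hg0]
    exact le_ciSup (hbdd x) 0
  have hfbd : IsBdd f := by
    refine ⟨A + (A + B) + B, fun x => abs_le.2 ⟨?_, ?_⟩⟩
    · have := (abs_nonneg _).trans (hA x)
      have := (abs_nonneg _).trans (hB x)
      linarith [huf x, (abs_le.1 (hB x)).1]
    · have := (abs_nonneg _).trans (hB x)
      linarith [ciSup_le fun n => hupper n x, (abs_le.1 (hA x)).2]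
  have hunif : TendstoUniformly g f atTop := by
    refine tendstoUniformly_of_forall_tendsto (fun ε hε => ?_) hlim
    obtain ⟨δ, hδ, h⟩ := laxNeg_equicontinuous hc hε
    refine ⟨δ, hδ, ?_⟩
    -- The iterate of index `0` is `u`, which may be discontinuous.
    filter_upwards [eventually_ge_atTop 1] with n hn x y hxy
    obtain ⟨m, rfl⟩ := Nat.exists_eq_add_of_le' hn
    rw [hsucc, hsucc, add_sub_add_right_eq_sub]
    exact h _ (hgbd m) x y hxy
  refine ⟨f, ⟨hfbd, fun x => ?_⟩, hlim, huf⟩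
  have h1 := (tendsto_laxNeg hC (Eventually.of_forall hgbd) hfbd hunif x).add_const
    (criticalValue c)
  refine tendsto_nhds_unique ((hlim x).comp (tendsto_add_atTop_nat 1)) (h1.congr fun n => ?_)
  exact (hsucc n x).symm

theorem continuous_laxNeg_add (hc : Continuous (Function.uncurry c)) {u : X → ℝ}
    (hu : IsBdd u) (κ : ℝ) : Continuous fun x => laxNeg c u x + κ :=
  (laxNeg_continuous hc hu).add continuous_const

/-- For `(x, y)` in the 2-Aubry set, the continuous subsolution `T⁻ u + c[0]` is calibrated on `(x,
y)`, and `T⁻ u y ≤ u x + c x y`; together they give `T⁻ u x + c[0] ≤ u x`. No continuity of `u` is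
needed. -/
theorem IsSubsolution.laxNeg_eq_on_aubrySet (hc : Continuous (Function.uncurry c)) {u : X → ℝ}
    (hu : IsSubsolution c u) {x : X} (hx : x ∈ aubrySet c) :
    laxNeg c u x + criticalValue c = u x := by
  obtain ⟨⟨x, y⟩, hxy, rfl⟩ := hx
  obtain ⟨C, hC⟩ := exists_cost_bound hc
  have h1 := hxy _ (continuous_laxNeg_add hc (hu.isBdd hc) _) (hu.laxNeg_add hc)
  simp only [nonStrictSet, Set.mem_ofPred_eq] at h1
  have h2 := laxNeg_le hC (hu.isBdd hc) x y
  have h3 := hu.le_laxNeg_add x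
  simp only
  linarith

theorem IsSubsolution.iterate_eq_on_aubrySet (hc : Continuous (Function.uncurry c)) {u : X → ℝ}
    (hu : IsSubsolution c u) {x : X} (hx : x ∈ aubrySet c) (n : ℕ) :
    (laxNeg c)^[n] u x + n * criticalValue c = u x := by
  induction n with
  | zero => simp
  | succ n ih =>
    rw [laxNeg_iterate_succ_add hc (hu.isBdd hc)]
    exact ((hu.iterate hc n).laxNeg_eq_on_aubrySet hc hx).trans ih

theorem IsSubsolution.average {u v : X → ℝ} (hu : IsSubsolution c u) (hv : IsSubsolution c v) :
    IsSubsolution c fun x => (u x + v x) / 2 := by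
  intro x y
  simp only
  linarith [hu x y, hv x y]

theorem isClosed_nonStrictSet (hc : Continuous (Function.uncurry c)) {u : X → ℝ}
    (hu : Continuous u) : IsClosed (nonStrictSet c u) := by
  have : Continuous fun p : X × X => c p.1 p.2 := hc
  exact isClosed_eq ((hu.comp continuous_snd).sub (hu.comp continuous_fst))
    (this.add continuous_const)

/-- The definition only provides successors. For a single continuous subsolution a predecessor
exists because `T⁻ + c[0]` fixes it at `x`; compactness then gives one common to all. -/
theorem exists_predecessor_of_mem_aubrySet (hc : Continuous (Function.uncurry c)) {x : X}
    (hx : x ∈ aubrySet c) : ∃ z, (z, x) ∈ twoAubrySet c := by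
  let ι := {u : X → ℝ // Continuous u ∧ IsSubsolution c u}
  let Z : ι → Set X := fun u => {z | (z, x) ∈ nonStrictSet c u.1}
  obtain ⟨w, hw⟩ := exists_isNegWeakKAM_criticalValue hc
  have : Nonempty ι := ⟨⟨w, hw.continuous hc, hw.isSubsolution hc⟩⟩
  have hclosed : ∀ u, IsClosed (Z u) := fun u =>
    (isClosed_nonStrictSet hc u.2.1).preimage (continuous_id.prodMk continuous_const)
  have hne : ∀ u, (Z u).Nonempty := fun u => by
    obtain ⟨z, hz⟩ := exists_laxNeg_eq hc u.2.1 x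
    refine ⟨z, ?_⟩
    have := u.2.2.laxNeg_eq_on_aubrySet hc hx
    simp only [Z, nonStrictSet, Set.mem_ofPred_eq]
    linarith
  -- Equality for the average of two subsolutions forces equality for each.
  have hdir : Directed (· ⊇ ·) Z := fun u v => by
    have hcont : Continuous fun y => (u.1 y + v.1 y) / 2 := (u.2.1.add v.2.1).div_const 2
    refine ⟨⟨_, hcont, u.2.2.average v.2.2⟩, ?_, ?_⟩ <;>
    · intro z hz
      have h1 := u.2.2 z x
      have h2 := v.2.2 z x
      simp only [Z, nonStrictSet, Set.mem_ofPred_eq] at hz ⊢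
      linarith
  obtain ⟨z, hz⟩ := IsCompact.nonempty_iInter_of_directed_nonempty_isCompact_isClosed Z hdir hne
    (fun u => (hclosed u).isCompact) hclosed
  exact ⟨z, fun u h1 h2 => Set.mem_iInter.1 hz ⟨u, h1, h2⟩⟩

end Subsolutions

/-! ### Duality between the negative and positive problems -/

section Swap

variable {X : Type*} [MetricSpace X] [CompactSpace X] [Nonempty X] [MeasurableSpace X]
  [BorelSpace X] {c : X → X → ℝ}

theorem isSubsolution_swap_neg (hc : Continuous (Function.uncurry c)) {u : X → ℝ} :
    IsSubsolution (fun a b => c b a) (fun x => -u x) ↔ IsSubsolution c u := by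
  simp only [IsSubsolution, criticalValue_swap hc]
  constructor
  · intro h x y
    linarith [h y x]
  · intro h x y
    linarith [h y x]

theorem isPosWeakKAM_iff (hc : Continuous (Function.uncurry c)) {u : X → ℝ} :
    IsPosWeakKAM c (criticalValue c) u ↔
      IsNegWeakKAM (fun a b => c b a) (criticalValue fun a b => c b a) fun x => -u x := by
  simp only [IsPosWeakKAM, IsNegWeakKAM, IsBdd, abs_neg, laxPos_eq_neg, criticalValue_swap hc]
  refine and_congr_right fun _ => forall_congr' fun x => ?_
  constructor <;> intro h <;> linarith

theorem laxPos_iterate (c : X → X → ℝ) (u : X → ℝ) (n : ℕ) (x : X) :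
    (laxPos c)^[n] u x = -(laxNeg fun a b => c b a)^[n] (fun y => -u y) x := by
  induction n generalizing x with
  | zero => simp
  | succ n ih =>
    rw [Function.iterate_succ_apply', Function.iterate_succ_apply', laxPos_eq_neg]
    simp only [ih, neg_neg]

theorem discountedPos_eq (hc : Continuous (Function.uncurry c)) {lam : ℝ} (h0 : 0 ≤ lam)
    (h1 : lam < 1) (x : X) :
    discountedPos c lam x = -discountedNeg (fun a b => c b a) lam x := by
  have hc' : Continuous (Function.uncurry fun a b => c b a) := hc.comp continuous_swap
  have h2 := (isDiscountedPos_iff c lam _).1 (discountedPos_spec c hc lam h0 h1)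
  have h3 := (existsUnique_discountedNeg _ hc' lam h0 h1).unique h2
    (discountedNeg_spec _ hc' lam h0 h1)
  rw [← h3, neg_neg]

/-- A predecessor for `c` is a successor for the swapped cost. -/
theorem mem_aubrySet_swap (hc : Continuous (Function.uncurry c)) {x : X}
    (hx : x ∈ aubrySet c) : x ∈ aubrySet fun a b => c b a := by
  obtain ⟨z, hz⟩ := exists_predecessor_of_mem_aubrySet hc hx
  refine ⟨(x, z), fun u hu hsub => ?_, rfl⟩
  have h1 : IsSubsolution c fun x => -u x := by
    rw [← isSubsolution_swap_neg hc]
    simpa only [neg_neg] using hsub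
  have hneg : Continuous fun x => -u x := hu.neg
  have h2 := hz _ hneg h1
  simp only [nonStrictSet, Set.mem_ofPred_eq, criticalValue_swap hc] at h2 ⊢
  linarith

theorem forall_isMatherMeasure_swap (hc : Continuous (Function.uncurry c))
    {P : Measure X → Prop} (h : ∀ μ, IsMatherMeasure c μ → P (μ.map Prod.fst)) :
    ∀ μ, IsMatherMeasure (fun a b => c b a) μ → P (μ.map Prod.fst) := by
  intro μ hμ
  have hc' : Continuous (Function.uncurry fun a b => c b a) := hc.comp continuous_swap
  rw [← hμ.map_fst_swap]
  exact h _ (hμ.swap hc')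

end Swap

/-! ### Mather measures and comparison on the Aubry set -/

section Aubry

variable {X : Type*} [MetricSpace X] [CompactSpace X] [Nonempty X] [MeasurableSpace X]
  [BorelSpace X] {c : X → X → ℝ}

/-- Mather measures are carried by the Aubry set. -/
theorem IsMatherMeasure.ae_mem_twoAubrySet (hc : Continuous (Function.uncurry c))
    {μ : Measure (X × X)} (hμ : IsMatherMeasure c μ) : ∀ᵐ p ∂μ, p ∈ twoAubrySet c := by
  have := hμ.prob
  -- The intersection over subsolutions is uncountable, but each point outside it has a
  -- neighbourhood excluded by a single `u`, and local nullity suffices.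
  refine measure_null_of_locally_null _ fun p hp => ?_
  obtain ⟨u, hu, hsub, hpu⟩ : ∃ u, Continuous u ∧ IsSubsolution c u ∧ p ∉ nonStrictSet c u := by
    by_contra! h
    exact hp h
  refine ⟨(nonStrictSet c u)ᶜ, mem_nhdsWithin_of_mem_nhds
    ((isClosed_nonStrictSet hc hu).isOpen_compl.mem_nhds hpu), ?_⟩
  have h1 : Integrable (fun p : X × X => c p.1 p.2 + criticalValue c) μ :=
    (integrable_of_continuous (continuous_cost hc)).add (integrable_const _)
  have h2 : Integrable (fun p : X × X => u p.2) μ :=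
    integrable_of_continuous (hu.comp continuous_snd)
  have h3 : Integrable (fun p : X × X => u p.1) μ :=
    integrable_of_continuous (hu.comp continuous_fst)
  have h4 : Integrable (fun p : X × X => u p.2 - u p.1) μ := h2.sub h3
  -- The defect of `u` is nonnegative with zero integral, hence null almost everywhere.
  have h5 : ∫ p, (c p.1 p.2 + criticalValue c - (u p.2 - u p.1)) ∂μ = 0 := by
    rw [integral_sub h1 h4, integral_sub h2 h3, integral_fst_eq_snd hμ.closed hu,
      integral_add (integrable_of_continuous (continuous_cost hc)) (integrable_const _),
      hμ.minimizing]
    simp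
  have h6 := (integral_eq_zero_iff_of_nonneg (fun p => by
    have := hsub p.1 p.2
    simp only [Pi.zero_apply, Pi.sub_apply]
    linarith) (h1.sub h4)).1 h5
  have h7 : ∀ᵐ p ∂μ, p ∈ nonStrictSet c u := by
    filter_upwards [h6] with p hp
    simp only [Pi.zero_apply, Pi.sub_apply] at hp
    simp only [nonStrictSet, Set.mem_ofPred_eq]
    linarith
  exact h7

theorem IsMatherMeasure.integral_congr_on_aubrySet (hc : Continuous (Function.uncurry c))
    {μ : Measure (X × X)} (hμ : IsMatherMeasure c μ) {u v : X → ℝ} (hu : Continuous u)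
    (hv : Continuous v) (h : ∀ x ∈ aubrySet c, u x = v x) :
    ∫ x, u x ∂(μ.map Prod.fst) = ∫ x, v x ∂(μ.map Prod.fst) := by
  rw [integral_map_fst_of_continuous hu, integral_map_fst_of_continuous hv]
  refine integral_congr_ae ?_
  filter_upwards [hμ.ae_mem_twoAubrySet hc] with p hp
  exact h _ ⟨p, hp, rfl⟩

theorem IsMatherMeasure.integrable_fst {μ : Measure (X × X)} (hμ : IsMatherMeasure c μ)
    {u : X → ℝ} (hu : Continuous u) : Integrable u (μ.map Prod.fst) := by
  have := hμ.prob
  have : IsProbabilityMeasure (μ.map Prod.fst) :=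
    Measure.isProbabilityMeasure_map measurable_fst.aemeasurable
  exact integrable_of_continuous hu

/-- Comparison only involves Mather integrals, which see nothing outside the Aubry set. -/
theorem IsNegWeakKAM.eq_of_eq_on_aubrySet (hc : Continuous (Function.uncurry c)) {u v : X → ℝ}
    (hu : IsNegWeakKAM c (criticalValue c) u) (hv : IsNegWeakKAM c (criticalValue c) v)
    (h : ∀ x ∈ aubrySet c, u x = v x) : u = v := by
  have key : ∀ {u v : X → ℝ}, IsNegWeakKAM c (criticalValue c) u →
      IsNegWeakKAM c (criticalValue c) v → (∀ x ∈ aubrySet c, u x = v x) → ∀ x, u x ≤ v x := by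
    intro u v hu hv h
    refine hv.le_of_integral_sub_nonpos hc (hu.continuous hc) (hu.isSubsolution hc)
      fun μ hμ => ?_
    rw [integral_sub (hμ.integrable_fst (hu.continuous hc))
      (hμ.integrable_fst (hv.continuous hc)),
      hμ.integral_congr_on_aubrySet hc (hu.continuous hc) (hv.continuous hc) h, sub_self]
  exact funext fun x => le_antisymm (key hu hv h x) (key hv hu (fun x hx => (h x hx).symm) x)

/-- On the Aubry set, two continuous subsolutions whose Mather integrals are nonpositive and
nonnegative respectively are ordered. -/
theorem le_on_aubrySet_of_integral (hc : Continuous (Function.uncurry c)) {u v : X → ℝ}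
    (hu : Continuous u) (hv : Continuous v) (husub : IsSubsolution c u)
    (hvsub : IsSubsolution c v)
    (hui : ∀ μ, IsMatherMeasure c μ → ∫ x, u x ∂(μ.map Prod.fst) ≤ 0)
    (hvi : ∀ μ, IsMatherMeasure c μ → 0 ≤ ∫ x, v x ∂(μ.map Prod.fst)) {x : X}
    (hx : x ∈ aubrySet c) : u x ≤ v x := by
  -- Predecessors stay in the Aubry set, so they chain into a backward orbit calibrated by every
  -- continuous subsolution; `u - v` is constant along it.
  have hstep : ∀ x : aubrySet c, ∃ z : aubrySet c, (z.1, x.1) ∈ twoAubrySet c := fun x => by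
    obtain ⟨z, hz⟩ := exists_predecessor_of_mem_aubrySet hc x.2
    exact ⟨⟨z, _, hz, rfl⟩, hz⟩
  choose b hb using hstep
  let s : ℕ → X := fun n => (b^[n] ⟨x, hx⟩ : aubrySet c)
  have hs : ∀ n, (s (n + 1), s n) ∈ twoAubrySet c := fun n => by
    simp only [s, Function.iterate_succ_apply']
    exact hb _
  have hcal : ∀ {w : X → ℝ}, Continuous w → IsSubsolution c w → ∀ n,
      w (s n) - w (s (n + 1)) = c (s (n + 1)) (s n) + criticalValue c :=
    fun hw hsub n => hs n _ hw hsub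
  obtain ⟨μ, h1, h2, h3, h4⟩ := exists_minimizing_of_calibrated hc hu (hcal hu husub)
  have hμ : IsMatherMeasure c μ := ⟨h1, h2, h3⟩
  have hdiff : Continuous fun x => u x - v x := hu.sub hv
  have hconst : ∀ n, u x - v x ≤ u (s n) - v (s n) := by
    intro n
    induction n with
    | zero => exact le_rfl
    | succ n ih => linarith [hcal hu husub n, hcal hv hvsub n]
  have h5 := h4 _ hdiff _ hconst
  rw [integral_sub (hμ.integrable_fst hu) (hμ.integrable_fst hv)] at h5
  linarith [hui μ hμ, hvi μ hμ]

end Aubry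

end DiscreteWeakKAM

/-! ### Assembly of the limits and the equivalences -/

theorem mainTheorem11 {X : Type*} [MetricSpace X] [CompactSpace X] [Nonempty X]
    [MeasurableSpace X] [BorelSpace X] (c : X → X → ℝ)
    (hc : Continuous (Function.uncurry c)) :
    ∃ u₁ v₁ : X → ℝ,
      TendstoUniformly
        (fun lam x => DiscreteWeakKAM.discountedNeg c lam x
          + DiscreteWeakKAM.criticalValue c / (1 - lam)) u₁ (𝓝[<] (1 : ℝ)) ∧
      TendstoUniformly
        (fun lam x => DiscreteWeakKAM.discountedPos c lam x
          - DiscreteWeakKAM.criticalValue c / (1 - lam)) v₁ (𝓝[<] (1 : ℝ)) ∧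
      DiscreteWeakKAM.IsNegWeakKAM c (DiscreteWeakKAM.criticalValue c) u₁ ∧
      DiscreteWeakKAM.IsPosWeakKAM c (DiscreteWeakKAM.criticalValue c) v₁ ∧
      (∀ x ∈ DiscreteWeakKAM.aubrySet c, u₁ x ≤ v₁ x) ∧
      List.TFAE [
        DiscreteWeakKAM.IsConjugatePair c u₁ v₁,
        ∀ x ∈ DiscreteWeakKAM.aubrySet c, u₁ x = v₁ x,
        ∀ x, v₁ x ≤ u₁ x,
        DiscreteWeakKAM.MatherIntegralZero c u₁,
        DiscreteWeakKAM.MatherIntegralZero c v₁,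
        ∃ v : X → ℝ, DiscreteWeakKAM.IsSubsolution c v ∧
          DiscreteWeakKAM.MatherIntegralZero c v] := by
  open DiscreteWeakKAM in
  have hc' : Continuous (Function.uncurry fun a b => c b a) := hc.comp continuous_swap
  obtain ⟨u, hu, huw, hui, humax⟩ := exists_tendstoUniformly_normalizedNeg hc
  obtain ⟨v', hv', hvw', hvi', hvmax'⟩ := exists_tendstoUniformly_normalizedNeg hc'
  obtain ⟨v, rfl⟩ : ∃ v : X → ℝ, v' = fun x => -v x := ⟨fun x => -v' x, by simp⟩
  have hvw : IsPosWeakKAM c (criticalValue c) v := (isPosWeakKAM_iff hc).2 hvw'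
  have hucont := huw.continuous hc
  have husub := huw.isSubsolution hc
  have hvcont : Continuous v := continuous_neg_iff.1 (hvw'.continuous hc')
  have hvsub : IsSubsolution c v := (isSubsolution_swap_neg hc).1 (hvw'.isSubsolution hc')
  have hvi : ∀ μ, IsMatherMeasure c μ → 0 ≤ ∫ x, v x ∂(μ.map Prod.fst) :=
    forall_isMatherMeasure_swap (P := fun ν => 0 ≤ ∫ x, v x ∂ν) hc' fun μ hμ => by
      have := hvi' μ hμ
      rw [integral_neg] at this
      linarith
  have hvmin : ∀ w : X → ℝ, Continuous w → IsSubsolution c w →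
      (∀ μ, IsMatherMeasure c μ → 0 ≤ ∫ x, w x ∂(μ.map Prod.fst)) → ∀ x, v x ≤ w x := by
    intro w hw hsub h x
    refine neg_le_neg_iff.1 (hvmax' (fun x => -w x) hw.neg ((isSubsolution_swap_neg hc).2 hsub)
      (forall_isMatherMeasure_swap (P := fun ν => ∫ x, -w x ∂ν ≤ 0) hc fun μ hμ => ?_) x)
    rw [integral_neg]
    linarith [h μ hμ]
  have hvlim : TendstoUniformly (fun lam x => discountedPos c lam x
      - criticalValue c / (1 - lam)) v (𝓝[<] (1 : ℝ)) := by
    refine Metric.tendstoUniformly_iff.2 fun ε hε => ?_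
    filter_upwards [Metric.tendstoUniformly_iff.1 hv' ε hε, eventually_mem_Ioo_nhdsLT_one]
      with lam h1 hlam x
    have h2 := h1 x
    rw [normalizedNeg, criticalValue_swap hc] at h2
    rw [discountedPos_eq hc hlam.1.le hlam.2, ← dist_neg_neg]
    convert h2 using 2
    ring
  have hle : ∀ x ∈ aubrySet c, u x ≤ v x := fun x hx =>
    le_on_aubrySet_of_integral hc hucont hvcont husub hvsub hui hvi hx
  refine ⟨u, v, hu, hvlim, huw, hvw, hle, ?_⟩
  have hposlim : ∀ {w : X → ℝ} {x : X}, IsSubsolution c w → x ∈ aubrySet c → ∀ n : ℕ,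
      (laxPos c)^[n] w x - n * criticalValue c = w x := by
    intro w x hw hx n
    have := ((isSubsolution_swap_neg hc).2 hw).iterate_eq_on_aubrySet hc'
      (mem_aubrySet_swap hc hx) n
    rw [criticalValue_swap hc] at this
    rw [laxPos_iterate]
    linarith
  -- The `T⁺` iterates of `u` converge, from below `u`, to a positive weak KAM solution equal to
  -- `u`, hence to `v`, on the Aubry set; it is therefore `v` everywhere.
  have hconj : (∀ x ∈ aubrySet c, u x = v x) → (∀ x, v x ≤ u x) ∧ ∀ x,
      Tendsto (fun n : ℕ => (laxPos c)^[n] u x - n * criticalValue c) atTop (𝓝 (v x)) := by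
    intro h
    obtain ⟨f, hf, hlim, hfle⟩ := ((isSubsolution_swap_neg hc).2 husub).exists_tendsto_iterate hc'
    have hfv : f = fun x => -v x := by
      refine hf.eq_of_eq_on_aubrySet hc' hvw' fun x hx => ?_
      have hx' : x ∈ aubrySet c := mem_aubrySet_swap hc' hx
      rw [← h x hx']
      refine tendsto_nhds_unique (hlim x) (tendsto_const_nhds.congr fun n => ?_)
      exact (((isSubsolution_swap_neg hc).2 husub).iterate_eq_on_aubrySet hc' hx n).symm
    subst hfv
    refine ⟨fun x => by linarith [hfle x], fun x => ?_⟩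
    have := (hlim x).neg
    rw [neg_neg] at this
    refine this.congr fun n => ?_
    rw [laxPos_iterate, criticalValue_swap hc]
    ring
  have huiter : ∀ n : ℕ, ∀ x, (laxNeg c)^[n] u x + n * criticalValue c = u x := by
    intro n
    induction n with
    | zero => simp
    | succ n ih =>
      intro x
      rw [laxNeg_iterate_succ_add hc huw.1, funext ih, ← huw.2 x]
  tfae_have 1 → 2 := by
    rintro ⟨w, hw, h1, h2⟩ x hx
    have h3 := tendsto_nhds_unique (h1 x)
      (tendsto_const_nhds.congr fun n => (hw.iterate_eq_on_aubrySet hc hx n).symm)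
    have h4 := tendsto_nhds_unique (h2 x)
      (tendsto_const_nhds.congr fun n => (hposlim hw hx n).symm)
    rw [h3, h4]
  tfae_have 2 → 1 := fun h =>
    ⟨u, husub, fun x => tendsto_const_nhds.congr fun n => (huiter n x).symm, (hconj h).2⟩
  tfae_have 2 → 3 := fun h => (hconj h).1
  tfae_have 3 → 2 := fun h x hx => le_antisymm (hle x hx) (h x)
  tfae_have 2 → 4 := fun h μ hμ => by
    refine ⟨hμ.integrable_fst hucont, le_antisymm (hui μ hμ) ?_⟩
    rw [hμ.integral_congr_on_aubrySet hc hucont hvcont h]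
    exact hvi μ hμ
  tfae_have 2 → 5 := fun h μ hμ => by
    refine ⟨hμ.integrable_fst hvcont, le_antisymm ?_ (hvi μ hμ)⟩
    rw [← hμ.integral_congr_on_aubrySet hc hucont hvcont h]
    exact hui μ hμ
  tfae_have 4 → 6 := fun h => ⟨u, husub, h⟩
  tfae_have 5 → 6 := fun h => ⟨v, hvsub, h⟩
  tfae_have 6 → 3 := by
    rintro ⟨w, hw, hw0⟩ x
    have hcont := continuous_laxNeg_add hc (hw.isBdd hc) (criticalValue c)
    have hint : ∀ μ, IsMatherMeasure c μ →
        ∫ x, (laxNeg c w x + criticalValue c) ∂(μ.map Prod.fst) = 0 := by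
      intro μ hμ
      obtain ⟨h1, h2⟩ := hw0 μ hμ
      -- `w` need not be continuous: its measurability for this marginal comes from the assumed
      -- integrability.
      rw [integral_map measurable_fst.aemeasurable h1.aestronglyMeasurable] at h2
      rw [integral_map_fst_of_continuous hcont, ← h2]
      refine integral_congr_ae ?_
      filter_upwards [hμ.ae_mem_twoAubrySet hc] with p hp
      exact hw.laxNeg_eq_on_aubrySet hc ⟨p, hp, rfl⟩
    exact (hvmin _ hcont (hw.laxNeg_add hc) (fun μ hμ => (hint μ hμ).ge) x).trans
      (humax _ hcont (hw.laxNeg_add hc) (fun μ hμ => (hint μ hμ).le) x)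
  tfae_finish
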